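/- Let $X,X_1,X_2,\dots$ be i.i.d. random vectors in $\mathbb R^p$ (defined on one probability space). Say that $X$ follows the independent component model (ICM) if $X=\mu+\Omega Z$ a.s. for some $\mu\in\mathbb R^p$, some nonsingular $p\times p$ matrix $\Omega$ and some random vector $Z$ with mutually independent components. Let $\hat\mu_n$, $\hat\Omega_n$ be measurable functions of $X_1,\dots,X_n$ with values in $\mathbb R^p$ and $\mathbb R^{p\times p}$, and let $\hat Z_j=\hat\Omega_n^{-1}(X_j-\hat\mu_n)=(\hat Z_{j1},\dots,\hat Z_{jp})^\top$, $j=1,\dots,n$, be the residuals (where, by convention, $\hat\Omega_n^{-1}:=0$ if $\hat\Omega_n$ is singular). For $y=(y_1,\dots,y_n)\in(\mathbb R^p)^n$ put $$T_{n,W}(y)=n\int_{\mathbb R^p}\Big|\frac1n\sum_{j=1}^n e^{\imath t^\top y_j}-\prod_{\ell=1}^p\frac1n\sum_{j=1}^n e^{\imath t_\ell y_{j\ell}}\Big|^2W(t)\,dt ,$$ and, for score functions $J_1,\dots,J_p:(0,1)\to\mathbb R$, $$\tilde T_{n,J,W}(y)=T_{n,W}\big((J_\ell(R_{j\ell}/(n+1)))_{j,\ell}\big),\qquad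 R_{j\ell}=\#\{k: y_{k\ell}\le y_{j\ell}\}.$$ Assume: 1. $W(t)>0$ for Lebesgue-a.e. $t\in\mathbb R^p$ and $\int_{\mathbb R^p} W(t)\,dt<\infty$; 2. $\hat\Omega_n\to\tilde\Omega$ a.s. for some nonrandom nonsingular matrix $\tilde\Omega$ (a pseudo-true value); 3. (alternative) $X$ does not follow the ICM. Then the tests that reject the ICM for large values of $S_n:=T_{n,W}$ at the residuals $\hat Z=(\hat Z_1,\dots,\hat Z_n)$ are consistent. If moreover every $J_\ell$ is strictly monotone on $(0,1)$ and every component of $\tilde\Omega^{-1}X$ has a continuous distribution function (as is the case when $X$ is absolutely continuous), then the tests that reject for large values of $S_n:=\tilde T_{n,J,W}$ at the residuals are consistent as well. In both cases consistency means the following. (i) For every $\alpha\in(0,1)$, $P(S_n(\hat Z)>q_{n,\alpha})\to1$ as $n\to\infty$, where $q_{n,\alpha}$ is the permutational critical value, i.e. the quantile of order $1-\alpha$ of the values $S_n(\hat Z^\pi)$ when $\pi=(\pi_1,\dots,\pi_p)$ ranges uniformly over all $p$-tuples of permutations of $\{1,\dots,n\}$, with $\hat Z^\pi_{j\ell}=\hat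 Z_{\pi_\ell(j)\,\ell}$. (ii) The same holds when, for any integers $M_n\ge1$, $q_{n,\alpha}$ is replaced by the quantile of order $1-\alpha$ of the values $S_n(\hat Z^{\pi})$ over $M_n$ such $p$-tuples $\pi$ drawn independently and uniformly, independently of the data. (iii) $P(S_n(\hat Z)>c_n)\to1$ for all (possibly random) critical values $c_n$ that are bounded above in probability, in particular for every fixed constant. Here the quantile of order $q$ of a finite family is the smallest real number $x$ such that a proportion at least $q$ of the family is $\le x$. -/

import Mathlib

open MeasureTheory ProbabilityTheory Filter Topology
open scoped Matrix ENNReal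

noncomputable section

namespace ICMTest

/-- The random vector `X` follows the independent component model: `X = m + A Z` almost surely for
some location `m`, some full-rank mixing matrix `A`, and some random vector `Z` whose components are
totally (mutually) independent. -/
def FollowsICM {Ω : Type*} [MeasurableSpace Ω] (P : Measure Ω) {p : ℕ}
    (X : Ω → Fin p → ℝ) : Prop :=
  ∃ (m : Fin p → ℝ) (A : Matrix (Fin p) (Fin p) ℝ) (Z : Ω → Fin p → ℝ),
    IsUnit A.det ∧ Measurable Z ∧ iIndepFun (fun (l : Fin p) ω => Z ω l) P ∧
      ∀ᵐ ω ∂P, X ω = m + A *ᵥ Z ω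

/-- Estimated residuals `A⁻¹ (x_j - m)` of the observations `x_1, …, x_n`. -/
def residuals {n p : ℕ} (m : Fin p → ℝ) (A : Matrix (Fin p) (Fin p) ℝ)
    (x : Fin n → Fin p → ℝ) : Fin n → Fin p → ℝ :=
  fun j => A⁻¹ *ᵥ (x j - m)

/-- Joint empirical characteristic function of `y_1, …, y_n`. -/
def jointECF {n p : ℕ} (y : Fin n → Fin p → ℝ) (t : Fin p → ℝ) : ℂ :=
  (1 / (n : ℂ)) * ∑ j, Complex.exp (Complex.I * ((∑ l, t l * y j l : ℝ) : ℂ))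

/-- Empirical characteristic function of the `l`-th components of `y_1, …, y_n`. -/
def margECF {n p : ℕ} (y : Fin n → Fin p → ℝ) (l : Fin p) (u : ℝ) : ℂ :=
  (1 / (n : ℂ)) * ∑ j, Complex.exp (Complex.I * ((u * y j l : ℝ) : ℂ))

/-- Joint empirical characteristic function minus the product of the marginal ones. -/
def ecfGap {n p : ℕ} (y : Fin n → Fin p → ℝ) (t : Fin p → ℝ) : ℂ :=
  jointECF y t - ∏ l, margECF y l (t l)

/-- The weighted L2 statistic `n ∫ |D_n(t)|² W(t) dt`, as a function of the residuals. -/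
def statT {p : ℕ} (W : (Fin p → ℝ) → ℝ) (n : ℕ) (y : Fin n → Fin p → ℝ) : ℝ :=
  n * ∫ t : Fin p → ℝ, ‖ecfGap y t‖ ^ 2 * W t

/-- Rank (between `1` and `n`) of `y_{jl}` among `y_{1l}, …, y_{nl}`. -/
def rankOf {n p : ℕ} (y : Fin n → Fin p → ℝ) (j : Fin n) (l : Fin p) : ℕ :=
  (Finset.univ.filter (fun k => y k l ≤ y j l)).card

/-- Scored ranks `J_l (R_{jl} / (n + 1))`. -/
def scoredRanks {n p : ℕ} (J : Fin p → ℝ → ℝ) (y : Fin n → Fin p → ℝ) : Fin n → Fin p → ℝ :=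
  fun j l => J l ((rankOf y j l : ℝ) / ((n : ℝ) + 1))

/-- The rank-based statistic: the weighted L2 statistic of the scored ranks. -/
def statRank {p : ℕ} (J : Fin p → ℝ → ℝ) (W : (Fin p → ℝ) → ℝ) (n : ℕ)
    (y : Fin n → Fin p → ℝ) : ℝ :=
  statT W n (scoredRanks J y)

/-- Permute the `n` values of each component `l` by its own permutation `π l`. -/
def permuteComponents {n p : ℕ} (π : Fin p → Equiv.Perm (Fin n)) (y : Fin n → Fin p → ℝ) :
    Fin n → Fin p → ℝ :=
  fun j l => y (π l j) l

/-- Quantile of order `q` of the uniform distribution over the finite family `v`: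
the smallest `x` such that a proportion at least `q` of the family is `≤ x`. -/
def empQuantile {ι : Type*} [Fintype ι] (q : ℝ) (v : ι → ℝ) : ℝ :=
  sInf {x : ℝ | q * (Fintype.card ι : ℝ) ≤ ((Finset.univ.filter (fun i => v i ≤ x)).card : ℝ)}

/-- Permutational critical value of level `α` of the statistic `S` at the residuals `y`: the
`(1 - α)`-quantile of the values of `S` over all `p`-tuples of permutations. (Simultaneous
permutations of all components do not change the statistics considered here, so each of the
`(n!)^(p-1)` essentially different configurations is counted `n!` times.) -/
def permCritical {n p : ℕ} (α : ℝ) (S : (Fin n → Fin p → ℝ) → ℝ) (y : Fin n → Fin p → ℝ) : ℝ :=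
  empQuantile (1 - α) (fun π : Fin p → Equiv.Perm (Fin n) => S (permuteComponents π y))

/-- Critical value of level `α` computed from `M` sampled `p`-tuples of permutations. -/
def sampledPermCritical {n p M : ℕ} (α : ℝ) (S : (Fin n → Fin p → ℝ) → ℝ)
    (s : Fin M → Fin p → Equiv.Perm (Fin n)) (y : Fin n → Fin p → ℝ) : ℝ :=
  empQuantile (1 - α) (fun i : Fin M => S (permuteComponents (s i) y))

section Tests

variable {Ω : Type*} [MeasurableSpace Ω] {p : ℕ}

/-- Power (rejection probability) at sample size `n` of the exact permutation test, which rejects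
when the statistic exceeds its permutational critical value; `Y n ω` are the residuals. -/
def permPower (P : Measure Ω) (Y : (n : ℕ) → Ω → Fin n → Fin p → ℝ)
    (S : (n : ℕ) → (Fin n → Fin p → ℝ) → ℝ) (α : ℝ) (n : ℕ) : ℝ≥0∞ :=
  P {ω | permCritical α (S n) (Y n ω) < S n (Y n ω)}

/-- Power at sample size `n` of the permutation test whose critical value is computed from `M`
`p`-tuples of permutations drawn independently and uniformly (with replacement), independently of
the data: the average over all possible draws of the rejection probability given the draw. -/
def sampledPermPower (P : Measure Ω) (Y : (n : ℕ) → Ω → Fin n → Fin p → ℝ)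
    (S : (n : ℕ) → (Fin n → Fin p → ℝ) → ℝ) (α : ℝ) (M n : ℕ) : ℝ≥0∞ :=
  (∑ s : Fin M → Fin p → Equiv.Perm (Fin n),
      P {ω | sampledPermCritical α (S n) s (Y n ω) < S n (Y n ω)}) /
    (Fintype.card (Fin M → Fin p → Equiv.Perm (Fin n)) : ℝ≥0∞)

/-- Consistency of the tests rejecting for large values of `S`: the rejection probability tends to
one, at every level `α ∈ (0, 1)`, with exact permutational critical values and with critical values
from any numbers `M n ≥ 1` of sampled permutations; and it tends to one for all critical values
that are (possibly random and) bounded above in probability, in particular for constant ones. -/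
def TestsConsistent (P : Measure Ω) (Y : (n : ℕ) → Ω → Fin n → Fin p → ℝ)
    (S : (n : ℕ) → (Fin n → Fin p → ℝ) → ℝ) : Prop :=
  (∀ α : ℝ, 0 < α → α < 1 → Tendsto (fun n => permPower P Y S α n) atTop (𝓝 1)) ∧
  (∀ α : ℝ, 0 < α → α < 1 → ∀ M : ℕ → ℕ, (∀ n, 1 ≤ M n) →
    Tendsto (fun n => sampledPermPower P Y S α (M n) n) atTop (𝓝 1)) ∧
  (∀ c : ℕ → Ω → ℝ,
    (∀ δ : ℝ≥0∞, 0 < δ → ∃ K : ℝ, ∀ᶠ n in atTop, P {ω | K < c n ω} ≤ δ) →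
    Tendsto (fun n => P {ω | c n ω < S n (Y n ω)}) atTop (𝓝 1))

end Tests

end ICMTest

end

/-! The critical values stay bounded while the statistic grows linearly in `n`.

Critical values: independent permutations of the components leave the marginal empirical
characteristic functions unchanged, and the permuted joint one has mean exactly their product. A
second-moment computation (`sum_perms_norm_sq_le`) bounds its mean squared error by `(p + 1) / n`,
whatever the data. Integrating against `W`, the factor `n` cancels, so the permutation mean of the
statistic is at most `(p + 1) * ∫ W` (`sum_perms_statT_le`). Markov's inequality bounds the exact
permutation quantile, and a second Markov step handles sampled permutations. Hence consistency
follows from almost sure divergence alone (`testsConsistent_of_tendsto_atTop`).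

Divergence: fix a path on which the empirical measures converge weakly and the scatter estimates
converge. The residual maps depend on the whole sample, but along this path they are deterministic
maps converging continuously, up to a location shift that affects neither statistic. The extended
continuous mapping theorem gives the limit of the gap at every frequency. The limiting gap is
continuous and `W > 0` a.e., so a zero limiting integral would make the components of `A⁻¹ X`
independent, and `X` would follow the ICM. The integral therefore has a positive limit, and
multiplication by `n` gives divergence (`tendsto_statT_atTop`).

Ranks: normalized ranks converge continuously to the limiting marginal distribution functions
(`tendsto_normRank`). Composing with these functions and the strictly monotone scores is injective
on sets of full measure, so dependence survives the transformation (`iIndepFun_of_injOn_comp`), and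
the same divergence argument applies. -/

noncomputable section

namespace ICMTest

/-! ### Weak convergence of empirical measures and extended continuous mapping -/

section Empirical

variable {E : Type*} [MeasurableSpace E]

/-- Empirical measure of the first `n` terms of a sequence. -/
def empMeasure (x : ℕ → E) (n : ℕ) : Measure E :=
  (n : ℝ≥0∞)⁻¹ • ∑ j : Fin n, Measure.dirac (x j)

lemma isProbabilityMeasure_empMeasure (x : ℕ → E) {n : ℕ} (hn : n ≠ 0) :
    IsProbabilityMeasure (empMeasure x n) := by
  constructor
  simp [empMeasure]
  exact ENNReal.inv_mul_cancel (by simpa using hn) (by simp)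

instance isFiniteMeasure_empMeasure (x : ℕ → E) (n : ℕ) : IsFiniteMeasure (empMeasure x n) := by
  rcases eq_or_ne n 0 with rfl | hn
  · constructor; simp [empMeasure]
  · have := isProbabilityMeasure_empMeasure x hn
    infer_instance

lemma integral_empMeasure [MeasurableSingletonClass E] {F : Type*} [NormedAddCommGroup F]
    [NormedSpace ℝ F] [CompleteSpace F] (x : ℕ → E) (n : ℕ) (f : E → F) :
    ∫ y, f y ∂(empMeasure x n) = (n : ℝ)⁻¹ • ∑ j : Fin n, f (x j) := by
  rw [empMeasure, integral_smul_measure, integral_finsetSum_measure]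
  · simp
  · intro i _
    exact integrable_dirac (by simp)

/-- This is the strong law for the indicator of `G`. The exceptional null set depends on `G`, so a
statement about all open sets has to pass through a countable family. -/
lemma tendsto_empMeasure {Ω : Type*} [MeasurableSpace Ω] (P : Measure Ω) [IsProbabilityMeasure P]
    (X : ℕ → Ω → E) (hX_meas : ∀ i, Measurable (X i)) (hX_indep : iIndepFun X P)
    (hX_ident : ∀ i, IdentDistrib (X i) (X 0) P P) {G : Set E} (hG : MeasurableSet G) :
    ∀ᵐ ω ∂P, Tendsto (fun n => empMeasure (fun i => X i ω) n G) atTop (𝓝 (P.map (X 0) G)) := by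
  have hφ : Measurable (G.indicator (fun _ => (1 : ℝ))) := measurable_const.indicator hG
  have key := strong_law_ae_real (μ := P) (fun i ω => G.indicator (fun _ => (1 : ℝ)) (X i ω))
    ?_ ?_ ?_
  · filter_upwards [key] with ω hω
    have h1 : ∀ n, empMeasure (fun i => X i ω) n G
        = ENNReal.ofReal ((∑ i ∈ Finset.range n, G.indicator (fun _ => (1 : ℝ)) (X i ω)) / n) := by
      intro n
      rcases eq_or_ne n 0 with rfl | hn
      · simp [empMeasure]
      have hn' : (0 : ℝ) < n := by positivity
      rw [ENNReal.ofReal_div_of_pos hn', ENNReal.ofReal_natCast, ENNReal.div_eq_inv_mul,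
        Finset.sum_range, ENNReal.ofReal_sum_of_nonneg
          (fun i _ => Set.indicator_nonneg (fun _ _ => zero_le_one) _)]
      simp only [empMeasure, Measure.smul_apply, Measure.finsetSum_apply, smul_eq_mul,
        Measure.dirac_apply' _ hG]
      congr 1
      refine Finset.sum_congr rfl fun i _ => ?_
      by_cases h : X i ω ∈ G <;> simp [h]
    simp_rw [h1]
    have h2 : P.map (X 0) G = ENNReal.ofReal (P[fun ω => G.indicator (fun _ => (1 : ℝ)) (X 0 ω)]) := by
      have : (fun ω => G.indicator (fun _ => (1 : ℝ)) (X 0 ω))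
          = (X 0 ⁻¹' G).indicator (fun _ => (1 : ℝ)) := rfl
      rw [this, integral_indicator_const _ (hX_meas 0 hG), Measure.map_apply (hX_meas 0) hG]
      simp
    rw [h2]
    exact ENNReal.tendsto_ofReal hω
  · exact (integrable_const (1 : ℝ)).indicator (hX_meas 0 hG) 
  · intro i j hij
    exact (hX_indep.indepFun hij).comp hφ hφ
  · intro i
    exact (hX_ident i).comp hφ

/-- The empirical measures of an i.i.d. sequence converge weakly almost surely (in the form of the
portmanteau inequality for open sets). -/
lemma ae_le_liminf_empMeasure [TopologicalSpace E] [SecondCountableTopology E] [BorelSpace E]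
    {Ω : Type*} [MeasurableSpace Ω] (P : Measure Ω) [IsProbabilityMeasure P]
    (X : ℕ → Ω → E) (hX_meas : ∀ i, Measurable (X i)) (hX_indep : iIndepFun X P)
    (hX_ident : ∀ i, IdentDistrib (X i) (X 0) P P) :
    ∀ᵐ ω ∂P, ∀ G : Set E, IsOpen G →
      P.map (X 0) G ≤ liminf (fun n => empMeasure (fun i => X i ω) n G) atTop := by
  set B := TopologicalSpace.countableBasis E
  have hB : B.Countable := TopologicalSpace.countable_countableBasis E
  have hopen : ∀ s ∈ B, IsOpen s := fun s hs => TopologicalSpace.isOpen_of_mem_countableBasis hs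
  -- Finite unions of basic open sets form a countable family, so one null set serves them all;
  -- every open set is an increasing limit of such unions.
  have hF : {s : Set (Set E) | s.Finite ∧ s ⊆ B}.Countable := Set.countable_ofPred_finite_subset hB
  have key : ∀ᵐ ω ∂P, ∀ s ∈ {s : Set (Set E) | s.Finite ∧ s ⊆ B},
      Tendsto (fun n => empMeasure (fun i => X i ω) n (⋃₀ s)) atTop (𝓝 (P.map (X 0) (⋃₀ s))) := by
    rw [ae_ball_iff hF]
    intro s hs
    exact tendsto_empMeasure P X hX_meas hX_indep hX_ident
      (isOpen_sUnion fun t ht => hopen t (hs.2 ht)).measurableSet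
  filter_upwards [key] with ω hω G hG
  set S := {s ∈ B | s ⊆ G}
  have hGS : G = ⋃₀ S :=
    (TopologicalSpace.isBasis_countableBasis E).open_eq_sUnion' hG
  rcases S.eq_empty_or_nonempty with hS | hS
  · rw [hGS, hS]; simp
  obtain ⟨f, hf⟩ := (hB.mono (Set.sep_subset _ _) : S.Countable).exists_eq_range hS
  have hfS : ∀ i, f i ∈ S := fun i => hf ▸ Set.mem_range_self i
  have hGf : G = ⋃ i, f i := by rw [hGS, hf, Set.sUnion_range]
  rw [hGf, measure_iUnion_eq_iSup_accumulate]
  refine iSup_le fun i => ?_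
  have hacc : Set.accumulate f i = ⋃₀ (f '' Set.Iic i) := by
    rw [Set.sUnion_image]; rfl
  have h1 := hω (f '' Set.Iic i) ⟨(Set.finite_Iic i).image f, by
    rintro _ ⟨j, _, rfl⟩; exact (hfS j).1⟩
  rw [hacc, ← h1.liminf_eq]
  refine liminf_le_liminf (Eventually.of_forall fun n => measure_mono ?_)
  rw [Set.sUnion_image]
  exact Set.iUnion₂_subset fun j _ => Set.subset_iUnion f j

/-- Extended continuous mapping theorem, lower bound for nonnegative functions. -/
lemma lintegral_le_liminf_of_tendsto_prod_nhds [TopologicalSpace E] [BorelSpace E]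
    {ν : ℕ → Measure E} {μ : Measure E}
    (hν : ∀ G : Set E, IsOpen G → μ G ≤ liminf (fun n => ν n G) atTop)
    {h' : ℕ → E → ℝ} {h : E → ℝ} (h'0 : ∀ n x, 0 ≤ h' n x) (h0 : ∀ x, 0 ≤ h x)
    (h'm : ∀ n, Measurable (h' n)) (hm : Measurable h)
    (hlim : ∀ᵐ x ∂μ, Tendsto (fun q : ℕ × E => h' q.1 q.2) (atTop ×ˢ 𝓝 x) (𝓝 (h x))) :
    ∫⁻ x, ENNReal.ofReal (h x) ∂μ
      ≤ liminf (fun n => ∫⁻ x, ENNReal.ofReal (h' n x) ∂(ν n)) atTop := by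
  rw [lintegral_eq_lintegral_meas_lt μ (ae_of_all _ h0) hm.aemeasurable]
  have e : ∀ n, ∫⁻ x, ENNReal.ofReal (h' n x) ∂(ν n)
      = ∫⁻ t in Set.Ioi (0 : ℝ), ν n {x | t < h' n x} := fun n =>
    lintegral_eq_lintegral_meas_lt (ν n) (ae_of_all _ (h'0 n)) (h'm n).aemeasurable
  simp_rw [e]
  refine le_trans ?_ (lintegral_liminf_le fun n => ?_)
  · refine lintegral_mono fun t => ?_
    -- Continuous convergence puts almost every point of `{t < h}` in the interior of the set where
    -- `t < h' n` for all `n ≥ k`, for some `k`. These interiors are open, so the portmanteau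
    -- inequality applies to each.
    set G : ℕ → Set E := fun k => interior {x | ∀ n ≥ k, t < h' n x}
    have hGmono : Monotone G := fun k l hkl =>
      interior_mono fun x hx n hn => hx n (hkl.trans hn)
    have h1 : μ {x | t < h x} ≤ μ (⋃ k, G k) := by
      refine measure_mono_ae ?_
      filter_upwards [hlim] with x hx htx
      have h2 := hx.eventually (lt_mem_nhds (show t < h x from htx))
      obtain ⟨pa, hpa, pb, hpb, h3⟩ := eventually_prod_iff.1 h2
      obtain ⟨k, hk⟩ := eventually_atTop.1 hpa
      refine Set.mem_iUnion.2 ⟨k, mem_interior_iff_mem_nhds.2 ?_⟩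
      filter_upwards [hpb] with y hy n hn
      exact h3 (hk n hn) hy
    refine h1.trans ?_
    rw [hGmono.measure_iUnion]
    refine iSup_le fun k => (hν (G k) isOpen_interior).trans ?_
    refine liminf_le_liminf ?_
    filter_upwards [eventually_ge_atTop k] with n hn
    exact measure_mono fun x hx => interior_subset hx n hn
  · exact Antitone.measurable fun s t hst =>
      measure_mono fun x hx => lt_of_le_of_lt hst hx

/-- Extended continuous mapping theorem: convergence of the integrals of uniformly bounded functions
that converge continuously. -/
lemma tendsto_integral_of_tendsto_prod_nhds [TopologicalSpace E] [BorelSpace E]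
    {ν : ℕ → Measure E} [∀ n, IsFiniteMeasure (ν n)] {μ : Measure E} [IsProbabilityMeasure μ]
    (hν1 : ∀ᶠ n in atTop, IsProbabilityMeasure (ν n))
    (hν : ∀ G : Set E, IsOpen G → μ G ≤ liminf (fun n => ν n G) atTop)
    {h' : ℕ → E → ℝ} {h : E → ℝ} {C : ℝ} (h'b : ∀ n x, |h' n x| ≤ C) (hb : ∀ x, |h x| ≤ C)
    (h'm : ∀ n, Measurable (h' n)) (hm : Measurable h)
    (hlim : ∀ᵐ x ∂μ, Tendsto (fun q : ℕ × E => h' q.1 q.2) (atTop ×ˢ 𝓝 x) (𝓝 (h x))) :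
    Tendsto (fun n => ∫ x, h' n x ∂(ν n)) atTop (𝓝 (∫ x, h x ∂μ)) := by
  have hint : ∀ (ρ : Measure E) [IsFiniteMeasure ρ] (g : E → ℝ), Measurable g →
      (∀ x, |g x| ≤ C) → Integrable g ρ := fun ρ _ g hg hgb =>
    Integrable.of_bound hg.aestronglyMeasurable C (ae_of_all _ hgb)
  have lower : ∀ (g' : ℕ → E → ℝ) (g : E → ℝ), (∀ n x, |g' n x| ≤ C) → (∀ x, |g x| ≤ C) →
      (∀ n, Measurable (g' n)) → Measurable g →
      (∀ᵐ x ∂μ, Tendsto (fun q : ℕ × E => g' q.1 q.2) (atTop ×ˢ 𝓝 x) (𝓝 (g x))) →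
      ∀ a < ∫ x, g x ∂μ, ∀ᶠ n in atTop, a < ∫ x, g' n x ∂(ν n) := by
    intro g' g hg'b hgb hg'm hgm hg a ha
    -- Adding `C` makes the functions nonnegative; the shift cancels because the total masses are
    -- eventually one.
    have h1 := lintegral_le_liminf_of_tendsto_prod_nhds hν (h' := fun n x => C + g' n x)
      (h := fun x => C + g x) (fun n x => by linarith [neg_le_of_abs_le (hg'b n x)])
      (fun x => by linarith [neg_le_of_abs_le (hgb x)]) (fun n => (hg'm n).const_add C)
      (hgm.const_add C) (hg.mono fun x hx => hx.const_add C)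
    have conv : ∀ (ρ : Measure E) [IsProbabilityMeasure ρ] (f : E → ℝ), Measurable f →
        (∀ x, |f x| ≤ C) →
        ∫⁻ x, ENNReal.ofReal (C + f x) ∂ρ = ENNReal.ofReal (C + ∫ x, f x ∂ρ) := by
      intro ρ _ f hf hfb
      have hi : Integrable (fun x => C + f x) ρ := (integrable_const C).add (hint ρ f hf hfb)
      rw [← ofReal_integral_eq_lintegral_ofReal hi
        (ae_of_all _ fun x => by
          have := neg_le_of_abs_le (hfb x)
          show 0 ≤ C + f x
          linarith),
        integral_add (integrable_const C) (hint ρ f hf hfb)]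
      simp
    rw [conv μ g hgm hgb] at h1
    -- Below `-C` the bound is automatic. Otherwise `C + ∫ g` is positive, and `ENNReal.ofReal`
    -- truncates nothing that matters.
    rcases lt_or_ge a (-C) with h2 | h2
    · filter_upwards [hν1] with n hn
      have := norm_integral_le_of_norm_le_const (μ := ν n) (C := C) (f := g' n) (ae_of_all _ (hg'b n))
      simp only [Real.norm_eq_abs, probReal_univ, mul_one] at this
      exact h2.trans_le (neg_le_of_abs_le this)
    · have h3 : ENNReal.ofReal (C + a) < ENNReal.ofReal (C + ∫ x, g x ∂μ) := by
        rw [ENNReal.ofReal_lt_ofReal_iff (by linarith)]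
        linarith
      have h4 := eventually_lt_of_lt_liminf (h3.trans_le h1)
      filter_upwards [h4, hν1] with n hn hn1
      rw [conv (ν n) (g' n) (hg'm n) (hg'b n), ENNReal.ofReal_lt_ofReal_iff'] at hn
      linarith [hn.1]
  refine tendsto_order.2 ⟨lower h' h h'b hb h'm hm hlim, fun a ha => ?_⟩
  have := lower (fun n x => - h' n x) (fun x => - h x) (by simpa using h'b) (by simpa using hb)
    (fun n => (h'm n).neg) hm.neg (hlim.mono fun x hx => hx.neg) (-a)
    (by rw [integral_neg]; linarith)
  filter_upwards [this] with n hn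
  rw [integral_neg] at hn
  linarith

/-- Extended continuous mapping theorem for complex functions. -/
lemma tendsto_integral_complex_of_tendsto_prod_nhds [TopologicalSpace E] [BorelSpace E]
    {ν : ℕ → Measure E} [∀ n, IsFiniteMeasure (ν n)] {μ : Measure E} [IsProbabilityMeasure μ]
    (hν1 : ∀ᶠ n in atTop, IsProbabilityMeasure (ν n))
    (hν : ∀ G : Set E, IsOpen G → μ G ≤ liminf (fun n => ν n G) atTop)
    {h' : ℕ → E → ℂ} {h : E → ℂ} {C : ℝ} (h'b : ∀ n x, ‖h' n x‖ ≤ C) (hb : ∀ x, ‖h x‖ ≤ C)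
    (h'm : ∀ n, Measurable (h' n)) (hm : Measurable h)
    (hlim : ∀ᵐ x ∂μ, Tendsto (fun q : ℕ × E => h' q.1 q.2) (atTop ×ˢ 𝓝 x) (𝓝 (h x))) :
    Tendsto (fun n => ∫ x, h' n x ∂(ν n)) atTop (𝓝 (∫ x, h x ∂μ)) := by
  have hint : ∀ (ρ : Measure E) [IsFiniteMeasure ρ] (g : E → ℂ), Measurable g →
      (∀ x, ‖g x‖ ≤ C) → Integrable g ρ := fun ρ _ g hg hgb =>
    Integrable.of_bound hg.aestronglyMeasurable C (ae_of_all _ hgb)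
  have hre := tendsto_integral_of_tendsto_prod_nhds hν1 hν
    (h' := fun n x => (h' n x).re) (h := fun x => (h x).re)
    (fun n x => (Complex.abs_re_le_norm _).trans (h'b n x))
    (fun x => (Complex.abs_re_le_norm _).trans (hb x))
    (fun n => Complex.measurable_re.comp (h'm n)) (Complex.measurable_re.comp hm)
    (hlim.mono fun x hx => (Complex.continuous_re.tendsto _).comp hx)
  have him := tendsto_integral_of_tendsto_prod_nhds hν1 hν
    (h' := fun n x => (h' n x).im) (h := fun x => (h x).im)
    (fun n x => (Complex.abs_im_le_norm _).trans (h'b n x))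
    (fun x => (Complex.abs_im_le_norm _).trans (hb x))
    (fun n => Complex.measurable_im.comp (h'm n)) (Complex.measurable_im.comp hm)
    (hlim.mono fun x hx => (Complex.continuous_im.tendsto _).comp hx)
  have dec : ∀ (ρ : Measure E) [IsFiniteMeasure ρ] (g : E → ℂ), Measurable g →
      (∀ x, ‖g x‖ ≤ C) →
      ∫ x, g x ∂ρ = ((∫ x, (g x).re ∂ρ : ℝ) : ℂ) + ((∫ x, (g x).im ∂ρ : ℝ) : ℂ) * Complex.I :=
    fun ρ _ g hg hgb => (integral_re_add_im (𝕜 := ℂ) (hint ρ g hg hgb)).symm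
  rw [dec μ h hm hb]
  simp_rw [fun n => dec (ν n) (h' n) (h'm n) (h'b n)]
  exact ((Complex.continuous_ofReal.tendsto _).comp hre).add
    (((Complex.continuous_ofReal.tendsto _).comp him).mul_const _)

end Empirical

/-! ### Second moments under random permutations -/

section Permutations

variable {n p : ℕ}

/-- Composition with a transposition shows that the sum does not depend on `j`, and summing over all
`j` merely reorders `g` under each permutation. -/
lemma sum_perm_apply (g : Fin n → ℂ) (j : Fin n) :
    (n : ℂ) * ∑ σ : Equiv.Perm (Fin n), g (σ j)
      = (Fintype.card (Equiv.Perm (Fin n)) : ℂ) * ∑ k, g k := by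
  have h1 : ∀ i, ∑ σ : Equiv.Perm (Fin n), g (σ i) = ∑ σ : Equiv.Perm (Fin n), g (σ j) := by
    intro i
    rw [← Equiv.sum_comp (Equiv.mulRight (Equiv.swap i j)) (fun σ => g (σ i))]
    simp
  have h2 : ∑ i, ∑ σ : Equiv.Perm (Fin n), g (σ i)
      = (Fintype.card (Equiv.Perm (Fin n)) : ℂ) * ∑ k, g k := by
    rw [Finset.sum_comm]
    simp_rw [fun σ : Equiv.Perm (Fin n) => Equiv.sum_comp σ g]
    simp
  rw [← h2]
  simp_rw [h1]
  simp

/-- Permutations act transitively on ordered pairs of distinct indices, so all `n (n - 1)` such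
pairs give the same sum; together they give the off-diagonal part of `F`. -/
lemma sum_perm_apply_apply (F : Fin n → Fin n → ℂ) {j k : Fin n} (hjk : j ≠ k) :
    (n : ℂ) * ((n : ℂ) - 1) * ∑ σ : Equiv.Perm (Fin n), F (σ j) (σ k)
      = (Fintype.card (Equiv.Perm (Fin n)) : ℂ) * (∑ a, ∑ b, F a b - ∑ a, F a a) := by
  have h1 : ∀ a b, a ≠ b → ∑ σ : Equiv.Perm (Fin n), F (σ a) (σ b)
      = ∑ σ : Equiv.Perm (Fin n), F (σ j) (σ k) := by
    intro a b hab
    obtain ⟨τ, ha, hb⟩ : ∃ τ : Equiv.Perm (Fin n), τ a = j ∧ τ b = k := by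
      refine ⟨Equiv.swap (Equiv.swap a j b) k * Equiv.swap a j, ?_, by simp⟩
      have : j ≠ Equiv.swap a j b := fun h =>
        hab ((Equiv.swap a j).injective ((Equiv.swap_apply_left a j).trans h))
      simp [Equiv.swap_apply_of_ne_of_ne this hjk]
    have := Equiv.sum_comp (Equiv.mulRight τ) (fun σ => F (σ a) (σ b))
    simpa [ha, hb] using this.symm
  have h2 : ∑ a, ∑ b, ∑ σ : Equiv.Perm (Fin n), F (σ a) (σ b)
      = (Fintype.card (Equiv.Perm (Fin n)) : ℂ) * ∑ a, ∑ b, F a b := by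
    have : ∀ σ : Equiv.Perm (Fin n), ∑ a, ∑ b, F (σ a) (σ b) = ∑ a, ∑ b, F a b := by
      intro σ
      simp_rw [fun a => Equiv.sum_comp σ (F a)]
      exact Equiv.sum_comp σ (fun a => ∑ b, F a b)
    simp_rw [fun a => Finset.sum_comm (s := Finset.univ) (t := Finset.univ)
      (f := fun b (σ : Equiv.Perm (Fin n)) => F (σ a) (σ b))]
    rw [Finset.sum_comm]
    simp [this]
  have h3 : ∑ a, ∑ σ : Equiv.Perm (Fin n), F (σ a) (σ a)
      = (Fintype.card (Equiv.Perm (Fin n)) : ℂ) * ∑ a, F a a := by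
    rw [Finset.sum_comm]
    simp_rw [fun σ : Equiv.Perm (Fin n) => Equiv.sum_comp σ (fun a => F a a)]
    simp
  rw [mul_sub (Fintype.card _ : ℂ), ← h2, ← h3, ← Finset.sum_sub_distrib]
  have h4 : ∀ a, ∑ b, ∑ σ : Equiv.Perm (Fin n), F (σ a) (σ b)
      - ∑ σ : Equiv.Perm (Fin n), F (σ a) (σ a)
      = ((n : ℂ) - 1) * ∑ σ : Equiv.Perm (Fin n), F (σ j) (σ k) := by
    intro a
    rw [← Finset.add_sum_erase _ _ (Finset.mem_univ a), add_sub_cancel_left,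
      Finset.sum_congr rfl fun b hb => h1 a b (Finset.ne_of_mem_erase hb).symm]
    have : 1 ≤ n := a.pos
    simp [Finset.card_erase_of_mem, Nat.cast_sub this]
  simp_rw [h4]
  simp [mul_assoc]

lemma sum_perms_prod (g : Fin p → Equiv.Perm (Fin n) → ℂ) :
    ∑ π : Fin p → Equiv.Perm (Fin n), ∏ l, g l (π l) = ∏ l, ∑ σ, g l σ := by
  rw [Finset.prod_univ_sum, Fintype.piFinset_univ]

lemma prod_sub_prod_le (s : Finset (Fin p)) (a b : Fin p → ℝ) (ε : ℝ) (ha : ∀ l, |a l| ≤ 1)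
    (hb : ∀ l, |b l| ≤ 1) (hab : ∀ l, |a l - b l| ≤ ε) :
    |∏ l ∈ s, a l - ∏ l ∈ s, b l| ≤ s.card * ε := by
  induction s using Finset.induction_on with
  | empty => simp
  | insert i s hi ih =>
    rw [Finset.prod_insert hi, Finset.prod_insert hi, Finset.card_insert_of_notMem hi]
    have e : a i * ∏ l ∈ s, a l - b i * ∏ l ∈ s, b l
        = a i * (∏ l ∈ s, a l - ∏ l ∈ s, b l) + (a i - b i) * ∏ l ∈ s, b l := by ring
    have h1 : |∏ l ∈ s, b l| ≤ 1 := by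
      rw [Finset.abs_prod]
      exact Finset.prod_le_one (fun l _ => abs_nonneg _) fun l _ => hb l
    rw [e]
    refine (abs_add_le _ _).trans ?_
    rw [abs_mul, abs_mul]
    have h2 := mul_le_mul (ha i) ih (abs_nonneg _) zero_le_one
    have h3 := mul_le_mul (hab i) h1 (abs_nonneg _) ((abs_nonneg _).trans (hab i))
    push_cast
    linarith

/-- Mean squared error of the joint empirical characteristic function under random permutations. -/
lemma sum_perms_norm_sq_le (hn : 2 ≤ n) (f : Fin p → Fin n → ℂ) (hf : ∀ l k, ‖f l k‖ = 1) :
    ∑ π : Fin p → Equiv.Perm (Fin n),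
      ‖(1 / (n : ℂ)) * ∑ j, ∏ l, f l (π l j) - ∏ l, (1 / (n : ℂ)) * ∑ k, f l k‖ ^ 2
      ≤ (p + 1) / n * Fintype.card (Fin p → Equiv.Perm (Fin n)) := by
  have hn0 : (n : ℂ) ≠ 0 := by exact_mod_cast (by omega : n ≠ 0)
  have hn1 : (n : ℂ) - 1 ≠ 0 := by
    rw [sub_ne_zero]; exact_mod_cast (by omega : n ≠ 1)
  have hnR : (2 : ℝ) ≤ n := by exact_mod_cast hn
  set M : ℝ := (Fintype.card (Equiv.Perm (Fin n)) : ℝ) with hM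
  have hMpos : 0 < M := by rw [hM]; exact_mod_cast Fintype.card_pos
  have hMc : (Fintype.card (Equiv.Perm (Fin n)) : ℂ) = (M : ℂ) := by simp [hM]
  have hN : (Fintype.card (Fin p → Equiv.Perm (Fin n)) : ℝ) = M ^ p := by
    simp [hM]
  set c : Fin p → ℂ := fun l => (1 / (n : ℂ)) * ∑ k, f l k with hc
  set m : ℂ := ∏ l, c l with hm
  set J : (Fin p → Equiv.Perm (Fin n)) → ℂ :=
    fun π => (1 / (n : ℂ)) * ∑ j, ∏ l, f l (π l j) with hJ
  have hc1 : ∀ l, ‖c l‖ ≤ 1 := by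
    intro l
    rw [hc]
    simp only [norm_mul, norm_div, norm_one, Complex.norm_natCast]
    have : ‖∑ k, f l k‖ ≤ n := by
      refine (norm_sum_le _ _).trans ?_
      simp [hf]
    rw [one_div, inv_mul_le_iff₀ (by linarith)]
    linarith
  set b : Fin p → ℝ := fun l => ‖c l‖ ^ 2 with hb
  have hb0 : ∀ l, 0 ≤ b l := fun l => by positivity
  have hb1 : ∀ l, b l ≤ 1 := fun l => pow_le_one₀ (norm_nonneg _) (hc1 l)
  -- `a l` is the permutation mean of `f l (σ j) * conj (f l (σ k))` for `j ≠ k`: sampling without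
  -- replacement removes the diagonal terms, each equal to one. It differs from `b l` by at most `1
  -- / (n - 1)`.
  set a : Fin p → ℝ := fun l => (n * b l - 1) / (n - 1) with ha
  have hab : ∀ l, |a l - b l| ≤ 1 / (n - 1) := by
    intro l
    have : a l - b l = -((1 - b l) / (n - 1)) := by
      rw [ha]; field_simp [show (n : ℝ) - 1 ≠ 0 by linarith]; ring
    rw [this, abs_neg, abs_div, abs_of_pos (show (0 : ℝ) < n - 1 by linarith),
      abs_of_nonneg (by linarith [hb1 l])]
    gcongr
    · linarith
    · linarith [hb0 l]
  have ha1 : ∀ l, |a l| ≤ 1 := by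
    intro l
    rw [ha, abs_le]
    constructor
    · rw [le_div_iff₀ (by linarith)]
      nlinarith [hb0 l]
    · rw [div_le_iff₀ (by linarith)]
      nlinarith [hb1 l]
  have hff : ∀ l k, f l k * (starRingEnd ℂ) (f l k) = 1 := by
    intro l k; rw [Complex.mul_conj', hf]; simp
  have pair : ∀ l j k, ∑ σ : Equiv.Perm (Fin n), f l (σ j) * (starRingEnd ℂ) (f l (σ k))
      = (M : ℂ) * (if j = k then 1 else (a l : ℂ)) := by
    intro l j k
    split_ifs with h
    · subst h
      simp [hff, hM]
    · have h1 := sum_perm_apply_apply (fun x y => f l x * (starRingEnd ℂ) (f l y)) h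
      have h2 : ∑ x, ∑ y, f l x * (starRingEnd ℂ) (f l y) = (n : ℂ) ^ 2 * (b l : ℂ) := by
        rw [← Finset.sum_mul_sum, ← map_sum, hb]
        simp only [hc]
        push_cast
        rw [← Complex.mul_conj']
        simp only [map_mul, map_div₀, map_one, Complex.conj_natCast]
        field_simp
      simp only [hff, h2, hMc] at h1
      rw [ha]
      push_cast
      simp only [Finset.sum_const, Finset.card_univ, Fintype.card_fin, nsmul_eq_mul, mul_one] at h1
      have h3 : (n : ℂ) * ((n - 1) * ∑ σ : Equiv.Perm (Fin n), f l (σ j) * (starRingEnd ℂ) (f l (σ k)))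
          = n * (M * (n * b l - 1)) := by
        rw [← mul_assoc, h1]; ring
      have h4 := mul_left_cancel₀ hn0 h3
      field_simp
      linear_combination h4
  have S1 : ∑ π, J π = (M : ℂ) ^ p * m := by
    simp only [hJ]
    rw [← Finset.mul_sum, Finset.sum_comm]
    simp_rw [fun j => sum_perms_prod (fun l (σ : Equiv.Perm (Fin n)) => f l (σ j))]
    have : ∀ l j, ∑ σ : Equiv.Perm (Fin n), f l (σ j) = M * c l := by
      intro l j
      have := sum_perm_apply (f l) j
      rw [hMc] at this
      simp only [hc]
      field_simp
      linear_combination this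
    simp_rw [this, Finset.prod_mul_distrib]
    simp [hm]
    field_simp
  have S2 : ∑ π, J π * (starRingEnd ℂ) (J π)
      = (M : ℂ) ^ p * (1 / n + (n - 1) / n * ((∏ l, a l : ℝ) : ℂ)) := by
    have e : ∀ π, J π * (starRingEnd ℂ) (J π) = (1 / (n : ℂ)) ^ 2 *
        ∑ j, ∑ k, ∏ l, (f l (π l j) * (starRingEnd ℂ) (f l (π l k))) := by
      intro π
      simp only [hJ, map_mul, map_sum, map_prod, map_div₀, map_one, Complex.conj_natCast,
        Finset.prod_mul_distrib]
      rw [← Finset.sum_mul_sum]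
      ring
    simp_rw [e]
    rw [← Finset.mul_sum, Finset.sum_comm]
    simp_rw [fun j => Finset.sum_comm (s := Finset.univ) (t := Finset.univ)
      (f := fun (π : Fin p → Equiv.Perm (Fin n)) k =>
        ∏ l, (f l (π l j) * (starRingEnd ℂ) (f l (π l k))))]
    simp_rw [fun j k => sum_perms_prod
      (fun l (σ : Equiv.Perm (Fin n)) => f l (σ j) * (starRingEnd ℂ) (f l (σ k)))]
    simp_rw [pair, Finset.prod_mul_distrib]
    have h1 : ∀ j k : Fin n, ∏ l : Fin p, (if j = k then (1 : ℂ) else (a l : ℂ))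
        = (if j = k then (1 - ∏ l, (a l : ℂ)) else 0) + ∏ l, (a l : ℂ) := by
      intro j k; split_ifs <;> simp
    simp_rw [h1]
    simp only [← Finset.mul_sum, Finset.sum_add_distrib]
    simp
    field_simp
    ring
  have S3 : ∑ π, ‖J π - m‖ ^ 2 = M ^ p * (1 / n + (n - 1) / n * (∏ l, a l) - ∏ l, b l) := by
    have hmm : m * (starRingEnd ℂ) m = ((∏ l, b l : ℝ) : ℂ) := by
      rw [Complex.mul_conj', hm, norm_prod]
      simp only [hb]
      push_cast
      rw [Finset.prod_pow]
    have : ((∑ π, ‖J π - m‖ ^ 2 : ℝ) : ℂ)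
        = (M : ℂ) ^ p * (1 / n + (n - 1) / n * ((∏ l, a l : ℝ) : ℂ) - ((∏ l, b l : ℝ) : ℂ)) := by
      push_cast
      simp_rw [← Complex.mul_conj']
      have e : ∀ π, (J π - m) * (starRingEnd ℂ) (J π - m) = J π * (starRingEnd ℂ) (J π)
          - J π * (starRingEnd ℂ) m - m * (starRingEnd ℂ) (J π) + m * (starRingEnd ℂ) m := by
        intro π; rw [map_sub]; ring
      simp_rw [e]
      rw [Finset.sum_add_distrib, Finset.sum_sub_distrib, Finset.sum_sub_distrib, S2,
        ← Finset.sum_mul Finset.univ J, ← Finset.mul_sum Finset.univ (fun π => (starRingEnd ℂ) (J π)) m,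
        ← map_sum, S1, map_mul, map_pow, Complex.conj_ofReal]
      have hcard : ∑ _π : Fin p → Equiv.Perm (Fin n), m * (starRingEnd ℂ) m
          = (M : ℂ) ^ p * (m * (starRingEnd ℂ) m) := by
        rw [Finset.sum_const, Finset.card_univ, nsmul_eq_mul]
        congr 1
        exact_mod_cast hN
      rw [hcard]
      push_cast at hmm ⊢
      linear_combination (-(M : ℂ) ^ p) * hmm
    apply Complex.ofReal_injective
    rw [this]
    push_cast
    rfl
  rw [S3, hN, mul_comm]
  refine mul_le_mul_of_nonneg_right ?_ (by positivity)
  have h1 := (abs_le.1 (prod_sub_prod_le Finset.univ a b (1 / (n - 1)) ha1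
    (fun l => abs_le.2 ⟨by linarith [hb0 l], hb1 l⟩) hab)).2
  have h2 : 0 ≤ ∏ l, b l := Finset.prod_nonneg fun l _ => hb0 l
  simp only [Finset.card_univ, Fintype.card_fin] at h1
  -- The error splits into the diagonal share, at most `1 / n`, and the without-replacement
  -- correction, at most `p / n` since the factor `n - 1` cancels.
  have e1 : 1 / (n : ℝ) + (n - 1) / n * (∏ l, a l) - ∏ l, b l
      = 1 / n * (1 - ∏ l, b l) + (n - 1) / n * (∏ l, a l - ∏ l, b l) := by
    field_simp; ring
  have e2 : ((p : ℝ) + 1) / n = 1 / n * 1 + (n - 1) / n * (p * (1 / (n - 1))) := by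
    field_simp [show (n : ℝ) - 1 ≠ 0 by linarith]; ring
  rw [e1, e2]
  have h3 : (0 : ℝ) ≤ (n - 1) / n := div_nonneg (by linarith) (by linarith)
  gcongr
  linarith

end Permutations

/-! ### The statistic and its permutation mean -/

section Statistic

variable {n p : ℕ}

lemma norm_exp_I_mul (x : ℝ) : ‖Complex.exp (Complex.I * (x : ℂ))‖ = 1 := by
  rw [mul_comm, Complex.norm_exp_ofReal_mul_I]

lemma norm_ecf_le_one (f : Fin n → ℝ) :
    ‖(1 / (n : ℂ)) * ∑ j, Complex.exp (Complex.I * (f j : ℂ))‖ ≤ 1 := by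
  rcases eq_or_ne n 0 with rfl | hn
  · simp
  rw [norm_mul, norm_div, norm_one, Complex.norm_natCast, one_div,
    inv_mul_le_iff₀ (by positivity)]
  refine (norm_sum_le _ _).trans ?_
  simp

lemma norm_ecfGap_le (y : Fin n → Fin p → ℝ) (t : Fin p → ℝ) : ‖ecfGap y t‖ ≤ 2 := by
  have h1 : ‖jointECF y t‖ ≤ 1 := norm_ecf_le_one fun j => ∑ l, t l * y j l
  have h2 : ‖∏ l, margECF y l (t l)‖ ≤ 1 := by
    rw [norm_prod]
    exact Finset.prod_le_one (fun _ _ => norm_nonneg _)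
      fun l _ => norm_ecf_le_one fun j => t l * y j l
  exact (norm_sub_le _ _).trans (by linarith)

lemma continuous_uncurry_ecfGap :
    Continuous fun q : (Fin n → Fin p → ℝ) × (Fin p → ℝ) => ecfGap q.1 q.2 := by
  unfold ecfGap jointECF margECF
  fun_prop

lemma norm_sq_ecfGap_mul_le (W : (Fin p → ℝ) → ℝ) (y : Fin n → Fin p → ℝ) (t : Fin p → ℝ) :
    ‖‖ecfGap y t‖ ^ 2 * W t‖ ≤ 4 * ‖W t‖ := by
  rw [norm_mul, norm_pow, norm_norm]
  gcongr
  nlinarith [norm_ecfGap_le y t, norm_nonneg (ecfGap y t)]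

variable {W : (Fin p → ℝ) → ℝ}

lemma integrable_norm_sq_ecfGap_mul (hW_int : Integrable W) (y : Fin n → Fin p → ℝ) :
    Integrable fun t => ‖ecfGap y t‖ ^ 2 * W t := by
  refine (hW_int.norm.const_mul 4).mono' ?_ (ae_of_all _ (norm_sq_ecfGap_mul_le W y))
  have : Continuous fun t => ‖ecfGap y t‖ ^ 2 :=
    ((continuous_uncurry_ecfGap.comp (Continuous.prodMk_right y)).norm).pow 2
  exact this.aestronglyMeasurable.mul hW_int.aestronglyMeasurable

lemma continuous_statT (hW_int : Integrable W) : Continuous (statT W n) := by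
  refine continuous_const.mul ?_
  refine continuous_of_dominated (fun y => (integrable_norm_sq_ecfGap_mul hW_int y).1)
    (fun y => ae_of_all _ (norm_sq_ecfGap_mul_le W y)) (hW_int.norm.const_mul 4)
    (ae_of_all _ fun t => ?_)
  exact (((continuous_uncurry_ecfGap.comp (Continuous.prodMk_left t)).norm).pow 2).mul_const _

lemma statT_nonneg (hW_pos : ∀ᵐ t : Fin p → ℝ, 0 < W t) (y : Fin n → Fin p → ℝ) :
    0 ≤ statT W n y := by
  refine mul_nonneg (Nat.cast_nonneg n) (integral_nonneg_of_ae ?_)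
  filter_upwards [hW_pos] with t ht
  positivity

/-- Only the order of summation changes. Under permutation the gap is thus a random joint term minus
a fixed centre. -/
lemma margECF_permuteComponents (π : Fin p → Equiv.Perm (Fin n)) (y : Fin n → Fin p → ℝ)
    (l : Fin p) (u : ℝ) : margECF (permuteComponents π y) l u = margECF y l u := by
  simp only [margECF, permuteComponents]
  rw [Equiv.sum_comp (π l) fun j => Complex.exp (Complex.I * ((u * y j l : ℝ) : ℂ))]

lemma exp_I_mul_sum (f : Fin p → ℝ) :
    Complex.exp (Complex.I * ((∑ l, f l : ℝ) : ℂ)) = ∏ l, Complex.exp (Complex.I * (f l : ℂ)) := by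
  rw [← Complex.exp_sum, Complex.ofReal_sum, Finset.mul_sum]

lemma sum_perms_norm_sq_ecfGap_le (hn : 2 ≤ n) (y : Fin n → Fin p → ℝ) (t : Fin p → ℝ) :
    ∑ π : Fin p → Equiv.Perm (Fin n), ‖ecfGap (permuteComponents π y) t‖ ^ 2
      ≤ (p + 1) / n * Fintype.card (Fin p → Equiv.Perm (Fin n)) := by
  refine le_trans (le_of_eq ?_) (sum_perms_norm_sq_le hn
    (fun l k => Complex.exp (Complex.I * ((t l * y k l : ℝ) : ℂ))) fun l k => norm_exp_I_mul _)
  refine Finset.sum_congr rfl fun π _ => ?_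
  simp only [ecfGap, margECF_permuteComponents]
  simp only [jointECF, exp_I_mul_sum, permuteComponents, margECF]

/-- The mean of the statistic over all permutations is bounded, uniformly in the data. -/
lemma sum_perms_statT_le (hW_pos : ∀ᵐ t : Fin p → ℝ, 0 < W t) (hW_int : Integrable W)
    (hn : 2 ≤ n) (y : Fin n → Fin p → ℝ) :
    ∑ π : Fin p → Equiv.Perm (Fin n), statT W n (permuteComponents π y)
      ≤ (p + 1) * (∫ t, W t) * Fintype.card (Fin p → Equiv.Perm (Fin n)) := by
  have hn0 : (0 : ℝ) < n := by positivity
  simp only [statT]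
  rw [← Finset.mul_sum, ← integral_finsetSum _ fun π _ => integrable_norm_sq_ecfGap_mul hW_int _]
  have h : ∫ t, ∑ π : Fin p → Equiv.Perm (Fin n), ‖ecfGap (permuteComponents π y) t‖ ^ 2 * W t
      ≤ ∫ t, (p + 1) / n * Fintype.card (Fin p → Equiv.Perm (Fin n)) * W t := by
    refine integral_mono_ae (integrable_finsetSum _ fun π _ =>
      integrable_norm_sq_ecfGap_mul hW_int _) (hW_int.const_mul _) ?_
    filter_upwards [hW_pos] with t ht
    rw [← Finset.sum_mul]
    exact mul_le_mul_of_nonneg_right (sum_perms_norm_sq_ecfGap_le hn y t) ht.le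
  rw [integral_const_mul] at h
  refine (mul_le_mul_of_nonneg_left h hn0.le).trans (le_of_eq ?_)
  field_simp

end Statistic

/-! ### Critical values and the consistency criterion -/

/-- Markov bound for the empirical quantile of a nonnegative family. -/
lemma empQuantile_le {ι : Type*} [Fintype ι] {α K : ℝ} (hα1 : α < 1) (hK : 0 < K)
    (v : ι → ℝ) (hv : ∀ i, 0 ≤ v i) (hsum : ∑ i, v i ≤ α * K * Fintype.card ι) :
    empQuantile (1 - α) v ≤ K := by
  classical
  have hmem : (1 - α) * (Fintype.card ι : ℝ)
      ≤ ((Finset.univ.filter (fun i => v i ≤ K)).card : ℝ) := by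
    have h1 : ((Finset.univ.filter (fun i => ¬ v i ≤ K)).card : ℝ) * K ≤ ∑ i, v i := by
      calc ((Finset.univ.filter (fun i => ¬ v i ≤ K)).card : ℝ) * K
          = ∑ i ∈ Finset.univ.filter (fun i => ¬ v i ≤ K), K := by simp
        _ ≤ ∑ i ∈ Finset.univ.filter (fun i => ¬ v i ≤ K), v i :=
            Finset.sum_le_sum fun i hi => (not_le.1 (Finset.mem_filter.1 hi).2).le
        _ ≤ ∑ i, v i := Finset.sum_le_sum_of_subset_of_nonneg (Finset.filter_subset _ _)
            fun i _ _ => hv i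
    have h2 : ((Finset.univ.filter (fun i => ¬ v i ≤ K)).card : ℝ) ≤ α * Fintype.card ι := by
      refine le_of_mul_le_mul_right ?_ hK
      linarith
    have h3 : ((Finset.univ.filter (fun i => v i ≤ K)).card : ℝ)
        + ((Finset.univ.filter (fun i => ¬ v i ≤ K)).card : ℝ) = Fintype.card ι := by
      exact_mod_cast Finset.card_filter_add_card_filter_not (s := Finset.univ) (fun i => v i ≤ K)
    linarith
  rcases isEmpty_or_nonempty ι with hι | hι
  -- For an empty family every real qualifies, and `sInf` of the whole line is `0` by convention.
  · have : {x : ℝ | (1 - α) * (Fintype.card ι : ℝ)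
        ≤ ((Finset.univ.filter (fun i => v i ≤ x)).card : ℝ)} = Set.univ := by
      ext x; simp
    rw [empQuantile, this, Real.sInf_univ]
    exact hK.le
  -- As `1 - α > 0`, any admissible `x` dominates some member of the nonnegative family; this gives
  -- the lower bound `0` that `csInf_le` needs.
  · refine csInf_le ⟨0, fun x hx => ?_⟩ hmem
    have hpos : (0 : ℝ) < ((Finset.univ.filter (fun i => v i ≤ x)).card : ℝ) := by
      refine lt_of_lt_of_le ?_ hx
      have : (0 : ℝ) < Fintype.card ι := by exact_mod_cast Fintype.card_pos
      exact mul_pos (by linarith) this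
    obtain ⟨i, hi⟩ := Finset.card_pos.1 (by exact_mod_cast hpos)
    exact (hv i).trans (Finset.mem_filter.1 hi).2

section Consistency

variable {Ω : Type*} [MeasurableSpace Ω] {p : ℕ}

lemma tendsto_one_of_forall_le_add {a : ℕ → ℝ≥0∞} (h1 : ∀ n, a n ≤ 1)
    (h : ∀ δ : ℝ≥0∞, 0 < δ → ∀ᶠ n in atTop, 1 ≤ a n + δ) : Tendsto a atTop (𝓝 1) := by
  refine tendsto_order.2 ⟨fun b hb => ?_, fun b hb => Eventually.of_forall fun n =>
    (h1 n).trans_lt hb⟩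
  obtain ⟨δ, hδ, hbδ⟩ := ENNReal.lt_iff_exists_add_pos_lt.1 hb
  filter_upwards [h δ (by exact_mod_cast hδ)] with n hn
  exact lt_of_add_lt_add_right (hbδ.trans_le hn)

lemma one_le_measure_add_compl (P : Measure Ω) [IsProbabilityMeasure P] (B : Set Ω) :
    1 ≤ P B + P Bᶜ := by
  rw [← measure_univ (μ := P), ← Set.union_compl_self B]
  exact measure_union_le _ _

/-- A coordinate of a uniformly drawn tuple is itself uniform. This transfers the permutation mean
bound to each sampled permutation. -/
lemma card_mul_sum_apply {ι Γ : Type*} [Fintype ι] [DecidableEq ι] [Fintype Γ] (g : Γ → ℝ)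
    (i : ι) :
    (Fintype.card Γ : ℝ) * ∑ s : ι → Γ, g (s i) = (Fintype.card (ι → Γ) : ℝ) * ∑ γ, g γ := by
  rw [Fintype.card_congr (Equiv.funSplitAt i Γ), Fintype.card_prod,
    ← Equiv.sum_comp (Equiv.funSplitAt i Γ).symm, Fintype.sum_prod_type]
  simp only [Equiv.funSplitAt_symm_apply, dite_true, Finset.sum_const, Finset.card_univ,
    nsmul_eq_mul, ← Finset.mul_sum]
  push_cast
  ring

/-- Sufficient conditions for consistency: the mean of the statistic over all permutations is
bounded, and the statistic diverges almost surely. -/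
lemma testsConsistent_of_tendsto_atTop (P : Measure Ω) [IsProbabilityMeasure P]
    (Y : (n : ℕ) → Ω → Fin n → Fin p → ℝ) (S : (n : ℕ) → (Fin n → Fin p → ℝ) → ℝ) {C : ℝ}
    (hS0 : ∀ n y, 0 ≤ S n y)
    (hSC : ∀ n, 2 ≤ n → ∀ y, ∑ π : Fin p → Equiv.Perm (Fin n), S n (permuteComponents π y)
      ≤ C * Fintype.card (Fin p → Equiv.Perm (Fin n)))
    (hSm : ∀ n (π : Fin p → Equiv.Perm (Fin n)),
      Measurable fun ω => S n (permuteComponents π (Y n ω)))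
    (hS : ∀ᵐ ω ∂P, Tendsto (fun n => S n (Y n ω)) atTop atTop) :
    TestsConsistent P Y S := by
  have hSm' : ∀ n, Measurable fun ω => S n (Y n ω) := fun n => hSm n fun _ => 1
  have hsmall : ∀ (K : ℝ) (δ : ℝ≥0∞), 0 < δ → ∀ᶠ n in atTop, P {ω | S n (Y n ω) ≤ K} ≤ δ := by
    intro K
    rw [← ENNReal.tendsto_nhds_zero, ← measure_empty (μ := P)]
    refine tendsto_measure_of_ae_tendsto_indicator_of_isFiniteMeasure atTop MeasurableSet.empty
      (fun n => measurableSet_le (hSm' n) measurable_const) ?_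
    filter_upwards [hS] with ω hω
    filter_upwards [hω.eventually_gt_atTop K] with n hn
    simpa using hn
  have hC0 : 0 ≤ C := by
    have h1 := hSC 2 le_rfl 0
    have h2 : (0 : ℝ) < Fintype.card (Fin p → Equiv.Perm (Fin 2)) := by
      exact_mod_cast Fintype.card_pos
    have h3 := (Finset.sum_nonneg fun π _ => hS0 2 (permuteComponents π 0)).trans h1
    exact nonneg_of_mul_nonneg_left h3 h2
  have bounded : ∀ c : ℕ → Ω → ℝ,
      (∀ δ : ℝ≥0∞, 0 < δ → ∃ K : ℝ, ∀ᶠ n in atTop, P {ω | K < c n ω} ≤ δ) →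
      Tendsto (fun n => P {ω | c n ω < S n (Y n ω)}) atTop (𝓝 1) := by
    intro c hc
    refine tendsto_one_of_forall_le_add (fun n => prob_le_one) fun δ hδ => ?_
    obtain ⟨K, hK⟩ := hc (δ / 2) (ENNReal.half_pos hδ.ne')
    filter_upwards [hK, hsmall K (δ / 2) (ENNReal.half_pos hδ.ne')] with n h1 h2
    refine (one_le_measure_add_compl P {ω | c n ω < S n (Y n ω)}).trans (add_le_add le_rfl ?_)
    calc P {ω | c n ω < S n (Y n ω)}ᶜ ≤ P ({ω | K < c n ω} ∪ {ω | S n (Y n ω) ≤ K}) := by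
          refine measure_mono fun ω hω => ?_
          rcases lt_or_ge K (c n ω) with h | h
          · exact Or.inl h
          · exact Or.inr ((not_lt.1 (by simpa using hω)).trans h)
      _ ≤ δ / 2 + δ / 2 := (measure_union_le _ _).trans (add_le_add h1 h2)
      _ = δ := ENNReal.add_halves δ
  refine ⟨fun α hα0 hα1 => ?_, fun α hα0 hα1 M hM => ?_, bounded⟩
  · refine bounded (fun n ω => permCritical α (S n) (Y n ω)) fun δ hδ => ⟨(C + 1) / α, ?_⟩
    filter_upwards [eventually_ge_atTop 2] with n hn
    have : {ω | (C + 1) / α < permCritical α (S n) (Y n ω)} = ∅ := by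
      refine Set.eq_empty_of_forall_notMem fun ω hω => not_le.2 (Set.mem_ofPred_eq ▸ hω) ?_
      refine empQuantile_le hα1 (by positivity) _ (fun π => hS0 n _) ((hSC n hn _).trans ?_)
      rw [mul_div_cancel₀ _ hα0.ne']
      gcongr
      linarith
    rw [this]; simp
  · refine tendsto_one_of_forall_le_add (fun n => ?_) fun δ hδ => ?_
    · refine ENNReal.div_le_of_le_mul ((Finset.sum_le_sum fun s _ => prob_le_one).trans ?_)
      simp
    -- The minimum with `1` keeps `ε` finite when `δ = ∞`. The choice of `K` below makes `α * K * ε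
    -- = C + 1`, which exceeds `C`.
    set ε : ℝ := (min (δ / 2) 1).toReal with hε
    have hε0 : 0 < ε := ENNReal.toReal_pos (by simp [hδ.ne']) (by simp)
    have hεδ : ENNReal.ofReal ε ≤ δ / 2 := by
      rw [hε, ENNReal.ofReal_toReal (by simp)]
      exact min_le_left _ _
    set K : ℝ := (C + 1) / (α * ε) with hK
    have hK0 : 0 < K := by positivity
    filter_upwards [eventually_ge_atTop 2, hsmall K (δ / 2) (ENNReal.half_pos hδ.ne')] with n hn h2
    have hMn : (0 : ℝ) < M n := by exact_mod_cast hM n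
    set N : ℝ≥0∞ := (Fintype.card (Fin (M n) → Fin p → Equiv.Perm (Fin n)) : ℝ≥0∞) with hN
    have hN0 : N ≠ 0 := by simp [hN]
    have hNt : N ≠ ∞ := by simp [hN]
    set V : (Fin (M n) → Fin p → Equiv.Perm (Fin n)) → Ω → ℝ :=
      fun s ω => ∑ i, S n (permuteComponents (s i) (Y n ω)) with hV
    have hVm : ∀ s, Measurable (V s) := fun s => Finset.measurable_fun_sum _ fun i _ => hSm n (s i)
    have hV0 : ∀ s ω, 0 ≤ V s ω := fun s ω => Finset.sum_nonneg fun i _ => hS0 n _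
    have hVsum : ∀ ω, ∑ s, V s ω
        ≤ C * M n * (Fintype.card (Fin (M n) → Fin p → Equiv.Perm (Fin n)) : ℝ) := by
      intro ω
      have hcard : (0 : ℝ) < Fintype.card (Fin p → Equiv.Perm (Fin n)) := by
        exact_mod_cast Fintype.card_pos
      have h3 : ∀ i : Fin (M n), ∑ s : Fin (M n) → Fin p → Equiv.Perm (Fin n),
          S n (permuteComponents (s i) (Y n ω))
          ≤ C * (Fintype.card (Fin (M n) → Fin p → Equiv.Perm (Fin n)) : ℝ) := by
        intro i
        refine le_of_mul_le_mul_left ?_ hcard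
        rw [card_mul_sum_apply (fun π => S n (permuteComponents π (Y n ω))) i]
        have := mul_le_mul_of_nonneg_left (hSC n hn (Y n ω)) (Nat.cast_nonneg (α := ℝ)
          (Fintype.card (Fin (M n) → Fin p → Equiv.Perm (Fin n))))
        linarith
      simp only [hV]
      rw [Finset.sum_comm]
      refine (Finset.sum_le_sum fun i _ => h3 i).trans (le_of_eq ?_)
      simp
      ring
    have hα : 0 < α * K * M n := by positivity
    -- First Markov step, over data and draws jointly: the total `V` of the sampled statistics
    -- rarely reaches `α * K * M n`. When it stays below, `empQuantile_le` is a second Markov step,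
    -- within the sample.
    have hD : ∑ s, P {ω | α * K * M n ≤ V s ω} ≤ N * (δ / 2) := by
      have h3 : ENNReal.ofReal (α * K * M n) * ∑ s, P {ω | α * K * M n ≤ V s ω}
          ≤ ENNReal.ofReal (α * K * M n) * (N * ENNReal.ofReal ε) := by
        calc ENNReal.ofReal (α * K * M n) * ∑ s, P {ω | α * K * M n ≤ V s ω}
            ≤ ∑ s, ∫⁻ ω, ENNReal.ofReal (V s ω) ∂P := by
              rw [Finset.mul_sum]
              refine Finset.sum_le_sum fun s _ => ?_
              refine le_trans (le_of_eq ?_) (mul_meas_ge_le_lintegral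
                (hVm s).ennreal_ofReal (ENNReal.ofReal (α * K * M n)))
              congr 2
              ext ω
              simp [ENNReal.ofReal_le_ofReal_iff (hV0 s ω)]
          _ = ∫⁻ ω, ENNReal.ofReal (∑ s, V s ω) ∂P := by
              rw [← lintegral_finsetSum _ fun s _ => (hVm s).ennreal_ofReal]
              refine lintegral_congr fun ω => ?_
              rw [ENNReal.ofReal_sum_of_nonneg fun s _ => hV0 s ω]
          _ ≤ ∫⁻ _, ENNReal.ofReal
                (C * M n * (Fintype.card (Fin (M n) → Fin p → Equiv.Perm (Fin n)) : ℝ)) ∂P :=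
              lintegral_mono fun ω => ENNReal.ofReal_le_ofReal (hVsum ω)
          _ ≤ ENNReal.ofReal (α * K * M n) * (N * ENNReal.ofReal ε) := by
              rw [lintegral_const, measure_univ, mul_one, hN, ← ENNReal.ofReal_natCast,
                ← ENNReal.ofReal_mul (Nat.cast_nonneg _), ← ENNReal.ofReal_mul hα.le]
              refine ENNReal.ofReal_le_ofReal ?_
              have : α * K * M n * ((Fintype.card (Fin (M n) → Fin p → Equiv.Perm (Fin n)) : ℝ) * ε)
                  = (C + 1) * M n
                    * (Fintype.card (Fin (M n) → Fin p → Equiv.Perm (Fin n)) : ℝ) := by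
                rw [hK]; field_simp
              rw [this]
              gcongr
              linarith
      refine ((ENNReal.mul_le_mul_iff_right (by simpa using hα) (by simp)).1 h3).trans ?_
      gcongr
    have hB : ∀ s : Fin (M n) → Fin p → Equiv.Perm (Fin n),
        P {ω | sampledPermCritical α (S n) s (Y n ω) < S n (Y n ω)}ᶜ
          ≤ δ / 2 + P {ω | α * K * M n ≤ V s ω} := by
      intro s
      refine le_trans (measure_mono fun ω hω => ?_) ((measure_union_le _ _).trans
        (add_le_add h2 le_rfl))
      rcases le_total (α * K * M n) (V s ω) with h | h
      · exact Or.inr h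
      · have h4 : S n (Y n ω) ≤ sampledPermCritical α (S n) s (Y n ω) :=
          not_lt.1 (by simpa using hω)
        refine Or.inl (h4.trans (empQuantile_le hα1 hK0 _ (fun i => hS0 n _) ?_))
        simpa using h
    rw [sampledPermPower, ← hN]
    refine (ENNReal.mul_le_mul_iff_right hN0 hNt).1 ?_
    rw [mul_one, mul_add, ENNReal.mul_div_cancel hN0 hNt]
    calc N = ∑ s : Fin (M n) → Fin p → Equiv.Perm (Fin n), 1 := by simp [hN]
      _ ≤ ∑ s, (P {ω | sampledPermCritical α (S n) s (Y n ω) < S n (Y n ω)}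
            + (δ / 2 + P {ω | α * K * M n ≤ V s ω})) :=
          Finset.sum_le_sum fun s _ =>
            (one_le_measure_add_compl P _).trans (add_le_add le_rfl (hB s))
      _ = ∑ s, P {ω | sampledPermCritical α (S n) s (Y n ω) < S n (Y n ω)}
            + (N * (δ / 2) + ∑ s, P {ω | α * K * M n ≤ V s ω}) := by
          rw [Finset.sum_add_distrib, Finset.sum_add_distrib, Finset.sum_const, Finset.card_univ,
            nsmul_eq_mul]
      _ ≤ _ := by
          refine add_le_add le_rfl ?_
          calc N * (δ / 2) + ∑ s, P {ω | α * K * M n ≤ V s ω}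
              ≤ N * (δ / 2) + N * (δ / 2) := add_le_add le_rfl hD
            _ = N * δ := by rw [← mul_add, ENNReal.add_halves]

end Consistency

/-! ### Divergence when the limiting components are dependent -/

section Divergence

variable {E : Type*} [MeasurableSpace E] {p : ℕ}

/-- Joint characteristic function of a random vector. -/
def jointCF (μ : Measure E) (T : E → Fin p → ℝ) (t : Fin p → ℝ) : ℂ :=
  ∫ x, Complex.exp (Complex.I * ((∑ l, t l * T x l : ℝ) : ℂ)) ∂μ

/-- Joint characteristic function minus the product of the marginal ones. -/
def cfGap (μ : Measure E) (T : E → Fin p → ℝ) (t : Fin p → ℝ) : ℂ :=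
  jointCF μ T t - ∏ l, jointCF μ T (Pi.single l (t l))

lemma sum_single_mul (l : Fin p) (u : ℝ) (z : Fin p → ℝ) :
    ∑ k, (Pi.single l u : Fin p → ℝ) k * z k = u * z l := by
  simp [Pi.single_apply]

/-- Restricting the frequency to an axis makes every marginal limit a case of the joint one. -/
lemma margECF_eq_jointECF {n : ℕ} (y : Fin n → Fin p → ℝ) (l : Fin p) (u : ℝ) :
    margECF y l u = jointECF y (Pi.single l u) := by
  simp only [margECF, jointECF, sum_single_mul]

lemma measurable_exp_I_mul_sum {T : E → Fin p → ℝ} (hT : Measurable T) (t : Fin p → ℝ) :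
    Measurable fun x => Complex.exp (Complex.I * ((∑ l, t l * T x l : ℝ) : ℂ)) := by
  have h : Continuous fun z : Fin p → ℝ =>
      Complex.exp (Complex.I * ((∑ l, t l * z l : ℝ) : ℂ)) := by fun_prop
  exact h.measurable.comp hT

lemma continuous_jointCF (μ : Measure E) [IsProbabilityMeasure μ] {T : E → Fin p → ℝ}
    (hT : Measurable T) : Continuous (jointCF μ T) := by
  refine continuous_of_dominated (fun t => (measurable_exp_I_mul_sum hT t).aestronglyMeasurable)
    (fun t => ae_of_all _ fun x => (norm_exp_I_mul _).le) (integrable_const 1)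
    (ae_of_all _ fun x => by fun_prop)

lemma continuous_cfGap (μ : Measure E) [IsProbabilityMeasure μ] {T : E → Fin p → ℝ}
    (hT : Measurable T) : Continuous (cfGap μ T) := by
  refine (continuous_jointCF μ hT).sub (continuous_finsetProd _ fun l _ => ?_)
  exact (continuous_jointCF μ hT).comp
    ((continuous_single (A := fun _ : Fin p => ℝ) l).comp (continuous_apply l))

/-- A vanishing gap says that the joint characteristic function factorizes, which is the criterion
`iIndepFun_iff_charFun_pi`. The rest is transport to Euclidean space, whose inner product supplies
the exponent. -/
lemma iIndepFun_of_cfGap_eq_zero (μ : Measure E) [IsProbabilityMeasure μ] {T : E → Fin p → ℝ}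
    (hT : Measurable T) (h : ∀ t, cfGap μ T t = 0) : iIndepFun (fun l x => T x l) μ := by
  have hTl : ∀ l, Measurable fun x => T x l := fun l => (measurable_pi_apply l).comp hT
  rw [iIndepFun_iff_charFun_pi fun l => (hTl l).aemeasurable]
  intro t
  have h1 := sub_eq_zero.1 (h (WithLp.ofLp t))
  have hm : Measurable fun x => WithLp.toLp 2 (T x) :=
    (WithLp.measurable_toLp 2 (Fin p → ℝ)).comp hT
  rw [charFun_apply, integral_map hm.aemeasurable (by fun_prop)]
  refine Eq.trans (integral_congr_ae (ae_of_all _ fun x => ?_))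
    (h1.trans (Finset.prod_congr rfl fun l _ => ?_))
  · simp only [PiLp.inner_apply, RCLike.inner_apply, conj_trivial]
    rw [mul_comm]
  · rw [charFun_apply_real, integral_map (hTl l).aemeasurable (by fun_prop)]
    simp only [jointCF, sum_single_mul]
    refine integral_congr_ae (ae_of_all _ fun x => ?_)
    simp only
    rw [mul_comm]
    push_cast
    rfl

/-- If the transformed observations converge and the limit has dependent components, then the
statistic diverges. -/
lemma tendsto_statT_atTop [TopologicalSpace E] [BorelSpace E] [MeasurableSingletonClass E]
    {W : (Fin p → ℝ) → ℝ}
    (hW_pos : ∀ᵐ t : Fin p → ℝ, 0 < W t) (hW_int : Integrable W)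
    {μ : Measure E} [IsProbabilityMeasure μ] {x : ℕ → E}
    (hx : ∀ G : Set E, IsOpen G → μ G ≤ liminf (fun n => empMeasure x n G) atTop)
    {T' : ℕ → E → Fin p → ℝ} {T : E → Fin p → ℝ} (hT' : ∀ n, Measurable (T' n))
    (hT : Measurable T)
    (hlim : ∀ᵐ z ∂μ, Tendsto (fun q : ℕ × E => T' q.1 q.2) (atTop ×ˢ 𝓝 z) (𝓝 (T z)))
    (hdep : ¬ iIndepFun (fun l z => T z l) μ) :
    Tendsto (fun n => statT W n (fun j : Fin n => T' n (x j))) atTop atTop := by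
  have hν1 : ∀ᶠ n in atTop, IsProbabilityMeasure (empMeasure x n) := by
    filter_upwards [eventually_ge_atTop 1] with n hn
    exact isProbabilityMeasure_empMeasure x (by omega)
  have hjoint : ∀ t, Tendsto (fun n => jointECF (fun j : Fin n => T' n (x j)) t) atTop
      (𝓝 (jointCF μ T t)) := by
    intro t
    have h := tendsto_integral_complex_of_tendsto_prod_nhds hν1 hx
      (h' := fun n z => Complex.exp (Complex.I * ((∑ l, t l * T' n z l : ℝ) : ℂ)))
      (h := fun z => Complex.exp (Complex.I * ((∑ l, t l * T z l : ℝ) : ℂ))) (C := 1)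
      (fun n z => (norm_exp_I_mul _).le) (fun z => (norm_exp_I_mul _).le)
      (fun n => measurable_exp_I_mul_sum (hT' n) t) (measurable_exp_I_mul_sum hT t)
      (hlim.mono fun z hz => by
        have hc : Continuous fun z : Fin p → ℝ =>
          Complex.exp (Complex.I * ((∑ l, t l * z l : ℝ) : ℂ)) := by fun_prop
        exact (hc.tendsto _).comp hz)
    refine h.congr fun n => ?_
    rw [integral_empMeasure, jointECF, Complex.real_smul]
    push_cast
    rw [one_div]
  have hgap : ∀ t, Tendsto (fun n => ecfGap (fun j : Fin n => T' n (x j)) t) atTop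
      (𝓝 (cfGap μ T t)) := by
    intro t
    simp only [ecfGap, margECF_eq_jointECF]
    exact (hjoint t).sub (tendsto_finsetProd _ fun l _ => hjoint _)
  have hint : Tendsto (fun n => ∫ t, ‖ecfGap (fun j : Fin n => T' n (x j)) t‖ ^ 2 * W t) atTop
      (𝓝 (∫ t, ‖cfGap μ T t‖ ^ 2 * W t)) :=
    tendsto_integral_of_dominated_convergence (fun t => 4 * ‖W t‖)
      (fun n => (integrable_norm_sq_ecfGap_mul hW_int _).1) (hW_int.norm.const_mul 4)
      (fun n => ae_of_all _ (norm_sq_ecfGap_mul_le W _))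
      (ae_of_all _ fun t => (((hgap t).norm).pow 2).mul_const _)
  have hle : ∀ t, ‖cfGap μ T t‖ ≤ 2 := fun t =>
    le_of_tendsto (hgap t).norm (Eventually.of_forall fun n => norm_ecfGap_le _ t)
  have hcont := continuous_cfGap μ hT
  have hnn : 0 ≤ᵐ[volume] fun t => ‖cfGap μ T t‖ ^ 2 * W t := by
    filter_upwards [hW_pos] with t ht
    positivity
  have hi : Integrable fun t => ‖cfGap μ T t‖ ^ 2 * W t := by
    refine (hW_int.norm.const_mul 4).mono'
      ((hcont.norm.pow 2).aestronglyMeasurable.mul hW_int.aestronglyMeasurable)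
      (ae_of_all _ fun t => ?_)
    rw [norm_mul, norm_pow, norm_norm]
    gcongr
    nlinarith [hle t, norm_nonneg (cfGap μ T t)]
  have hpos : 0 < ∫ t, ‖cfGap μ T t‖ ^ 2 * W t := by
    refine lt_of_le_of_ne (integral_nonneg_of_ae hnn) fun h0 => hdep ?_
    -- A zero integral with `W > 0` a.e. kills the gap almost everywhere; continuity extends this to
    -- every frequency.
    refine iIndepFun_of_cfGap_eq_zero μ hT fun t => ?_
    have h1 := (integral_eq_zero_iff_of_nonneg_ae hnn hi).1 h0.symm
    have h2 : cfGap μ T =ᵐ[volume] fun _ => 0 := by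
      filter_upwards [h1, hW_pos] with t ht hWt
      simpa [hWt.ne'] using ht
    exact congrFun ((hcont.ae_eq_iff_eq volume continuous_const).1 h2) t
  exact tendsto_natCast_atTop_atTop.atTop_mul_pos hpos hint

end Divergence

/-! ### Transfer of independence -/

section Independence

variable {Ω : Type*} [MeasurableSpace Ω] {P : Measure Ω}

lemma iIndepFun_map_iff {ι E : Type*} [MeasurableSpace E] {X : Ω → E} (hX : Measurable X)
    {g : ι → E → ℝ} (hg : ∀ i, Measurable (g i)) :
    iIndepFun g (P.map X) ↔ iIndepFun (fun i ω => g i (X ω)) P := by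
  simp only [iIndepFun_iff_measure_inter_preimage_eq_mul]
  refine forall_congr' fun S => forall_congr' fun s => forall_congr' fun hs => ?_
  rw [Measure.map_apply hX (Finset.measurableSet_biInter S fun i hi => hg i (hs i hi)),
    Finset.prod_congr rfl fun i hi => Measure.map_apply hX (hg i (hs i hi))]
  simp only [Set.preimage_iInter]
  rfl

/-- Independence is reflected by measurable maps that are injective on sets of full measure. -/
lemma iIndepFun_of_injOn_comp {ι : Type*} {Z : ι → Ω → ℝ} {h : ι → ℝ → ℝ} {B : ι → Set ℝ}
    (hh : ∀ i, Measurable (h i)) (hB : ∀ i, MeasurableSet (B i))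
    (hBinj : ∀ i, Set.InjOn (h i) (B i)) (hZB : ∀ i, ∀ᵐ ω ∂P, Z i ω ∈ B i)
    (hind : iIndepFun (fun i ω => h i (Z i ω)) P) : iIndepFun Z P := by
  rw [iIndepFun_iff_measure_inter_preimage_eq_mul] at hind ⊢
  intro S s hs
  -- Lusin–Souslin: a measurable map that is injective on a Borel set has a Borel image there.
  -- Events about `Z i` thus become, up to null sets, events about `h i (Z i)`.
  have himg : ∀ i ∈ S, MeasurableSet (h i '' (s i ∩ B i)) := fun i hi =>
    ((hs i hi).inter (hB i)).image_of_measurable_injOn (hh i)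
      ((hBinj i).mono Set.inter_subset_right)
  have hiff : ∀ i, ∀ᵐ ω ∂P, (ω ∈ Z i ⁻¹' s i ↔
      ω ∈ (fun ω => h i (Z i ω)) ⁻¹' (h i '' (s i ∩ B i))) := by
    intro i
    filter_upwards [hZB i] with ω hω
    simp only [Set.mem_preimage]
    refine ⟨fun hs => ⟨_, ⟨hs, hω⟩, rfl⟩, ?_⟩
    rintro ⟨z, ⟨hz, hzB⟩, hzeq⟩
    rwa [← hBinj i hzB hω hzeq]
  have h1 : ∀ i, P (Z i ⁻¹' s i) = P ((fun ω => h i (Z i ω)) ⁻¹' (h i '' (s i ∩ B i))) :=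
    fun i => measure_congr ((hiff i).mono fun ω hω => propext hω)
  have h2 : P (⋂ i ∈ S, Z i ⁻¹' s i)
      = P (⋂ i ∈ S, (fun ω => h i (Z i ω)) ⁻¹' (h i '' (s i ∩ B i))) := by
    refine measure_congr ?_
    have := (ae_ball_iff S.countable_toSet).2 fun i (_ : i ∈ S) => hiff i
    filter_upwards [this] with ω hω
    refine propext ?_
    show ω ∈ (⋂ i ∈ S, Z i ⁻¹' s i) ↔ ω ∈ (⋂ i ∈ S, _)
    simp only [Set.mem_iInter]
    exact forall₂_congr fun i hi => hω i hi
  rw [h2, hind S himg]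
  exact Finset.prod_congr rfl fun i _ => (h1 i).symm

end Independence

/-! ### Continuous distribution functions and score functions -/

section DistributionFunction

/-- A distribution function is right-continuous, and its jump at `a` is the mass of `{a}`. -/
lemma continuous_cdf (ν : Measure ℝ) [IsProbabilityMeasure ν] [NullSingletonClass ν] :
    Continuous (cdf ν) := by
  refine continuous_iff_continuousAt.2 fun a => ?_
  rw [(cdf ν).mono.continuousAt_iff_leftLim_eq_rightLim, (cdf ν).rightLim_eq]
  have h := (cdf ν).measure_singleton a
  rw [measure_cdf, measure_singleton] at h
  refine le_antisymm ((cdf ν).mono.leftLim_le le_rfl) ?_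
  have := ENNReal.ofReal_eq_zero.1 h.symm
  linarith

/-- The distribution function of an atomless measure has null level sets. -/
lemma measure_cdf_eq (ν : Measure ℝ) [IsProbabilityMeasure ν] [NullSingletonClass ν] (u : ℝ) :
    ν {s | cdf ν s = u} = 0 := by
  have hcover : {s | cdf ν s = u} ⊆ ⋃ k : ℕ, ({s | cdf ν s = u} ∩ Set.Icc (-k : ℝ) k) := by
    intro s hs
    obtain ⟨k, hk⟩ := exists_nat_ge |s|
    exact Set.mem_iUnion.2 ⟨k, hs, abs_le.1 hk⟩
  refine measure_mono_null hcover (measure_iUnion_null fun k => ?_)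
  have hcl : IsClosed {s | cdf ν s = u} := isClosed_eq (continuous_cdf ν) continuous_const
  have hK : IsCompact ({s | cdf ν s = u} ∩ Set.Icc (-k : ℝ) k) := isCompact_Icc.inter_left hcl
  rcases ({s | cdf ν s = u} ∩ Set.Icc (-k : ℝ) k).eq_empty_or_nonempty with he | hne
  · rw [he, measure_empty]
  obtain ⟨a, ha⟩ := hK.exists_isLeast hne
  obtain ⟨b, hb⟩ := hK.exists_isGreatest hne
  -- The compact piece lies between its extreme points, where the distribution function takes the
  -- same value, so the whole interval has measure zero.
  refine measure_mono_null (t := Set.Icc a b) (fun s hs => ⟨ha.2 hs, hb.2 hs⟩) ?_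
  have ha1 : cdf ν a = u := ha.1.1
  have hb1 : cdf ν b = u := hb.1.1
  rw [← Ioc_ae_eq_Icc.measure_eq, ← measure_cdf ν, StieltjesFunction.measure_Ioc, ha1, hb1]
  simp

/-- A Borel set of full measure on which the distribution function is injective with values in
the open unit interval. -/
lemma exists_injOn_cdf (ν : Measure ℝ) [IsProbabilityMeasure ν] [NullSingletonClass ν] :
    ∃ B : Set ℝ, MeasurableSet B ∧ (∀ᵐ s ∂ν, s ∈ B) ∧ Set.InjOn (cdf ν) B ∧
      Set.MapsTo (cdf ν) B (Set.Ioo 0 1) := by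
  have hm : ∀ u, MeasurableSet {s | cdf ν s = u} := fun u =>
    (cdf ν).mono.measurable (measurableSet_singleton u)
  have hae : ∀ u, ∀ᵐ s ∂ν, cdf ν s ≠ u := fun u => by
    rw [ae_iff]; simpa using measure_cdf_eq ν u
  -- Two points with equal value have a rational between them, with that same value by monotonicity.
  -- Removing the countably many null level sets through rationals therefore gives injectivity.
  refine ⟨{s | cdf ν s ≠ 0} ∩ {s | cdf ν s ≠ 1} ∩ ⋂ q : ℚ, {s | cdf ν s ≠ cdf ν q}, ?_, ?_, ?_, ?_⟩
  · exact ((hm 0).compl.inter (hm 1).compl).inter (MeasurableSet.iInter fun q => (hm _).compl)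
  · have := ae_all_iff.2 fun q : ℚ => hae (cdf ν q)
    filter_upwards [hae 0, hae 1, this] with s h0 h1 h2
    exact ⟨⟨h0, h1⟩, Set.mem_iInter.2 h2⟩
  · have key : ∀ s t, (∀ q : ℚ, cdf ν s ≠ cdf ν q) → s < t → cdf ν s ≠ cdf ν t := by
      intro s t hs hst heq
      obtain ⟨q, hsq, hqt⟩ := exists_rat_btwn hst
      exact hs q (le_antisymm ((cdf ν).mono hsq.le) (heq ▸ (cdf ν).mono hqt.le))
    intro s hs t ht heq
    rcases lt_trichotomy s t with h | h | h
    · exact absurd heq (key s t (Set.mem_iInter.1 hs.2) h)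
    · exact h
    · exact absurd heq.symm (key t s (Set.mem_iInter.1 ht.2) h)
  · intro s hs
    exact ⟨lt_of_le_of_ne (cdf_nonneg ν s) (Ne.symm hs.1.1), lt_of_le_of_ne (cdf_le_one ν s) hs.1.2⟩

end DistributionFunction

/-- A strictly monotone score function agrees on the unit interval with a measurable function. -/
lemma exists_measurable_score {J : ℝ → ℝ}
    (hJ : StrictMonoOn J (Set.Ioo 0 1) ∨ StrictAntiOn J (Set.Ioo 0 1)) :
    ∃ J' : ℝ → ℝ, Measurable J' ∧ Set.EqOn J' J (Set.Ioo 0 1) ∧ Set.InjOn J' (Set.Ioo 0 1) ∧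
      ∃ D : Set ℝ, D.Countable ∧ ∀ u ∈ Set.Ioo (0 : ℝ) 1, u ∉ D → ContinuousAt J' u := by
  have heq : Set.EqOn ((Set.Ioo 0 1).indicator J) J (Set.Ioo 0 1) := Set.eqOn_indicator
  -- Outside the unit interval `J` is arbitrary, possibly nonmeasurable, so it is replaced by zero
  -- there.
  refine ⟨(Set.Ioo 0 1).indicator J, ?_, heq, ?_,
    {u ∈ Set.Ioo 0 1 | ¬ ContinuousWithinAt J (Set.Ioo 0 1) u}, ?_, ?_⟩
  · refine measurable_of_restrict_of_restrict_compl (s := Set.Ioo 0 1) measurableSet_Ioo ?_ ?_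
    · have h0 : (Set.Ioo 0 1).domRestrict ((Set.Ioo 0 1).indicator J)
          = fun a : Set.Ioo (0 : ℝ) 1 => J a :=
        funext fun a => heq a.2
      rw [h0]
      rcases hJ with h | h
      · exact Monotone.measurable fun a b hab => h.monotoneOn a.2 b.2 hab
      · exact Antitone.measurable fun a b hab => h.antitoneOn a.2 b.2 hab
    · have h0 : (Set.Ioo (0 : ℝ) 1)ᶜ.domRestrict ((Set.Ioo 0 1).indicator J) = fun _ => 0 :=
        funext fun a => Set.indicator_of_notMem a.2 J
      rw [h0]
      exact measurable_const
  · refine heq.injOn_iff.2 ?_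
    rcases hJ with h | h
    · exact h.injOn
    · exact h.injOn
  · rcases hJ with h | h
    · exact h.monotoneOn.countable_not_continuousWithinAt
    · exact h.antitoneOn.countable_not_continuousWithinAt
  · intro u hu hD
    have hc : ContinuousWithinAt J (Set.Ioo 0 1) u := by
      by_contra hc
      exact hD ⟨hu, hc⟩
    exact (hc.congr heq (heq hu)).continuousAt (isOpen_Ioo.mem_nhds hu)

/-! ### Convergence of normalized ranks -/

section Ranks

variable {E : Type*} [MeasurableSpace E]

/-- Rank of `g z` among `g (x 0), …, g (x (n - 1))`, divided by `n + 1`. -/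
def normRank (x : ℕ → E) (g : E → ℝ) (n : ℕ) (z : E) : ℝ :=
  ((Finset.univ.filter (fun k : Fin n => g (x k) ≤ g z)).card : ℝ) / (n + 1)

lemma measurable_normRank (x : ℕ → E) {g : E → ℝ} (hg : Measurable g) (n : ℕ) :
    Measurable (normRank x g n) := by
  have : normRank x g n
      = fun z => (∑ k : Fin n, if g (x k) ≤ g z then (1 : ℝ) else 0) / (n + 1) := by
    funext z
    simp [normRank, Finset.sum_boole]
  rw [this]
  refine (Finset.measurable_fun_sum _ fun k _ => ?_).div_const _
  exact Measurable.ite (measurableSet_le measurable_const hg) measurable_const measurable_const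

/-- Normalized ranks of converging linear statistics converge to the distribution function. -/
lemma tendsto_normRank [TopologicalSpace E] [BorelSpace E] [FirstCountableTopology E] [MeasurableSingletonClass E]
    {μ : Measure E} [IsProbabilityMeasure μ] {x : ℕ → E}
    (hx : ∀ G : Set E, IsOpen G → μ G ≤ liminf (fun n => empMeasure x n G) atTop)
    {g' : ℕ → E → ℝ} {g : E → ℝ} (hg' : ∀ n, Measurable (g' n)) (hg : Measurable g)
    (hlim : ∀ z, Tendsto (fun q : ℕ × E => g' q.1 q.2) (atTop ×ˢ 𝓝 z) (𝓝 (g z)))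
    (hatom : ∀ c, μ {z | g z = c} = 0) (z : E) :
    Tendsto (fun q : ℕ × E => normRank x (g' q.1) q.1 q.2) (atTop ×ˢ 𝓝 z)
      (𝓝 (cdf (μ.map g) (g z))) := by
  have := Measure.isProbabilityMeasure_map (μ := μ) hg.aemeasurable
  -- The threshold moves with both the sample size and the point. Along a sequence it depends on the
  -- index only, and the rank becomes an empirical integral of a converging indicator; convergence
  -- can fail only on the null set `g y = g z`.
  refine tendsto_of_seq_tendsto fun s hs => ?_
  have hs1 : Tendsto (fun k => (s k).1) atTop atTop := tendsto_fst.comp hs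
  have hgs : Tendsto (fun k => g' (s k).1 (s k).2) atTop (𝓝 (g z)) := (hlim z).comp hs
  have hlim' : ∀ y, Tendsto (fun q : ℕ × E => g' (s q.1).1 q.2) (atTop ×ˢ 𝓝 y) (𝓝 (g y)) :=
    fun y => (hlim y).comp ((hs1.comp tendsto_fst).prodMk tendsto_snd)
  have hint := tendsto_integral_of_tendsto_prod_nhds (C := 1) (μ := μ)
    (ν := fun k => empMeasure x (s k).1)
    (h' := fun k => {y | g' (s k).1 y ≤ g' (s k).1 (s k).2}.indicator 1)
    (h := {y | g y ≤ g z}.indicator 1)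
    (by
      filter_upwards [hs1.eventually_ge_atTop 1] with k hk
      exact isProbabilityMeasure_empMeasure x (by omega))
    (fun G hG => (hx G hG).trans (liminf_le_liminf_of_le hs1))
    (fun k y => by by_cases h : y ∈ {y | g' (s k).1 y ≤ g' (s k).1 (s k).2} <;> simp [h])
    (fun y => by by_cases h : y ∈ {y | g y ≤ g z} <;> simp [h])
    (fun k => measurable_one.indicator (measurableSet_le (hg' _) measurable_const))
    (measurable_one.indicator (measurableSet_le hg measurable_const))
    (by
      have hne : ∀ᵐ y ∂μ, g y ≠ g z := by rw [ae_iff]; simpa using hatom (g z)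
      filter_upwards [hne] with y hy
      have hgs' : Tendsto (fun q : ℕ × E => g' (s q.1).1 (s q.1).2) (atTop ×ˢ 𝓝 y) (𝓝 (g z)) :=
        hgs.comp tendsto_fst
      refine tendsto_const_nhds.congr' ?_
      rcases lt_or_gt_of_ne hy with h | h
      · filter_upwards [(hlim' y).eventually_lt hgs' h] with q hq
        simp [h.le, hq.le]
      · filter_upwards [hgs'.eventually_lt (hlim' y) h] with q hq
        simp [h, hq])
  have hval : ∫ y, {y | g y ≤ g z}.indicator (1 : E → ℝ) y ∂μ = cdf (μ.map g) (g z) := by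
    rw [integral_indicator_one (measurableSet_le hg measurable_const), cdf_eq_real,
      map_measureReal_apply hg measurableSet_Iic]
    rfl
  rw [hval] at hint
  have hfac : Tendsto (fun k => ((s k).1 : ℝ) / ((s k).1 + 1)) atTop (𝓝 1) :=
    (tendsto_natCast_div_add_atTop (1 : ℝ)).comp hs1
  have hmul := hfac.mul hint
  rw [one_mul] at hmul
  refine hmul.congr fun k => ?_
  rw [integral_empMeasure]
  simp only [normRank, Function.comp_apply]
  rcases eq_or_ne (s k).1 0 with h0 | h0
  · have : IsEmpty (Fin (s k).1) := by rw [h0]; infer_instance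
    simp [h0]
  · have : ((s k).1 : ℝ) ≠ 0 := by exact_mod_cast h0
    simp only [Set.indicator_apply, Set.mem_ofPred_eq, Pi.one_apply, Finset.sum_boole, smul_eq_mul]
    field_simp

end Ranks

/-! ### Invariance, measurability and convergence of residuals -/

section Residuals

variable {n p : ℕ}

/-- A common shift multiplies the joint term and the product of marginals by the same unimodular
factor. The location estimate therefore drops out, and nothing about its limit is needed. -/
lemma norm_ecfGap_sub (y : Fin n → Fin p → ℝ) (c t : Fin p → ℝ) :
    ‖ecfGap (fun j => y j - c) t‖ = ‖ecfGap y t‖ := by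
  have hexp : ∀ a b : ℝ, Complex.exp (Complex.I * ((a - b : ℝ) : ℂ))
      = Complex.exp (Complex.I * ((-b : ℝ) : ℂ)) * Complex.exp (Complex.I * (a : ℂ)) := by
    intro a b
    rw [← Complex.exp_add]
    push_cast
    ring_nf
  have hj : jointECF (fun j => y j - c) t
      = Complex.exp (Complex.I * ((∑ l, -(t l * c l) : ℝ) : ℂ)) * jointECF y t := by
    simp only [jointECF, Pi.sub_apply, mul_sub, Finset.sum_sub_distrib, hexp, ← Finset.mul_sum,
      Finset.sum_neg_distrib]
    ring
  have hm : ∀ l, margECF (fun j => y j - c) l (t l)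
      = Complex.exp (Complex.I * ((-(t l * c l) : ℝ) : ℂ)) * margECF y l (t l) := by
    intro l
    simp only [margECF, Pi.sub_apply, mul_sub, hexp, ← Finset.mul_sum]
    ring
  have : ecfGap (fun j => y j - c) t
      = Complex.exp (Complex.I * ((∑ l, -(t l * c l) : ℝ) : ℂ)) * ecfGap y t := by
    rw [ecfGap, ecfGap, hj]
    simp only [hm, Finset.prod_mul_distrib]
    rw [exp_I_mul_sum, mul_sub]
  rw [this, norm_mul, norm_exp_I_mul, one_mul]

lemma residuals_eq (m : Fin p → ℝ) (A : Matrix (Fin p) (Fin p) ℝ) (x : Fin n → Fin p → ℝ) :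
    residuals m A x = fun j => A⁻¹ *ᵥ x j - A⁻¹ *ᵥ m := by
  funext j
  simp only [residuals, Matrix.mulVec_sub]

lemma statT_residuals (W : (Fin p → ℝ) → ℝ) (m : Fin p → ℝ) (A : Matrix (Fin p) (Fin p) ℝ)
    (x : Fin n → Fin p → ℝ) :
    statT W n (residuals m A x) = statT W n (fun j => A⁻¹ *ᵥ x j) := by
  simp only [statT, residuals_eq, norm_ecfGap_sub]

lemma scoredRanks_residuals (J : Fin p → ℝ → ℝ) (m : Fin p → ℝ)
    (A : Matrix (Fin p) (Fin p) ℝ) (x : Fin n → Fin p → ℝ) :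
    scoredRanks J (residuals m A x) = scoredRanks J (fun j => A⁻¹ *ᵥ x j) := by
  simp only [residuals_eq]
  funext j l
  simp [scoredRanks, rankOf]

/-- Ranks travel with their observations, so the rank statistic of permuted data is `statT` of
permuted scores and inherits its bound. -/
lemma scoredRanks_permuteComponents (J : Fin p → ℝ → ℝ) (π : Fin p → Equiv.Perm (Fin n))
    (y : Fin n → Fin p → ℝ) :
    scoredRanks J (permuteComponents π y) = permuteComponents π (scoredRanks J y) := by
  funext j l
  have : rankOf (permuteComponents π y) j l = rankOf y (π l j) l := by
    exact Finset.card_equiv (π l) fun i => by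
      rw [Finset.mem_filter, Finset.mem_filter]
      simp [permuteComponents]
  simp only [scoredRanks, permuteComponents, this]

/-- Ranks take countably many values, so no measurability of the scores is needed. -/
lemma measurable_scoredRanks (J : Fin p → ℝ → ℝ) :
    Measurable (scoredRanks J : (Fin n → Fin p → ℝ) → Fin n → Fin p → ℝ) := by
  refine measurable_pi_lambda _ fun j => measurable_pi_lambda _ fun l => ?_
  have hr : Measurable fun y : Fin n → Fin p → ℝ => rankOf y j l := by
    simp only [rankOf, Finset.card_filter]
    refine Finset.measurable_fun_sum _ fun k _ => ?_
    refine Measurable.ite (measurableSet_le ?_ ?_) measurable_const measurable_const <;> fun_prop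
  exact (measurable_of_countable fun r : ℕ => J l ((r : ℝ) / ((n : ℝ) + 1))).comp hr

lemma measurable_permuteComponents (π : Fin p → Equiv.Perm (Fin n)) :
    Measurable (permuteComponents π : (Fin n → Fin p → ℝ) → Fin n → Fin p → ℝ) := by
  refine measurable_pi_lambda _ fun j => measurable_pi_lambda _ fun l => ?_
  simp only [permuteComponents]
  fun_prop

lemma measurable_matrix_inv {Ω : Type*} [MeasurableSpace Ω] {A : Ω → Matrix (Fin p) (Fin p) ℝ}
    (hA : ∀ k l, Measurable fun ω => A ω k l) (k l : Fin p) :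
    Measurable fun ω => (A ω)⁻¹ k l := by
  have hA' : Measurable fun ω => (fun k l => A ω k l : Fin p → Fin p → ℝ) :=
    measurable_pi_lambda _ fun k => measurable_pi_lambda _ fun l => hA k l
  have hid : Continuous fun a : Fin p → Fin p → ℝ => (Matrix.of a : Matrix (Fin p) (Fin p) ℝ) :=
    continuous_id
  have hdet : Measurable fun a : Fin p → Fin p → ℝ => (Matrix.of a).det :=
    hid.matrix_det.measurable
  have hadj : Measurable fun a : Fin p → Fin p → ℝ => (Matrix.of a).adjugate k l :=
    (hid.matrix_adjugate.matrix_elem k l).measurable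
  have : (fun ω => (A ω)⁻¹ k l) = fun ω => ((A ω).det)⁻¹ * (A ω).adjugate k l := by
    funext ω
    rw [Matrix.inv_def, Ring.inverse_eq_inv', Matrix.smul_apply, smul_eq_mul]
  rw [this]
  exact (hdet.comp hA').inv.mul (hadj.comp hA')

lemma measurable_residuals {Ω : Type*} [MeasurableSpace Ω] {m : Ω → Fin p → ℝ}
    {A : Ω → Matrix (Fin p) (Fin p) ℝ} {x : Ω → Fin n → Fin p → ℝ} (hm : Measurable m)
    (hA : ∀ k l, Measurable fun ω => A ω k l) (hx : Measurable x) :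
    Measurable fun ω => residuals (m ω) (A ω) (x ω) := by
  refine measurable_pi_lambda _ fun j => measurable_pi_lambda _ fun l => ?_
  simp only [residuals, Matrix.mulVec, dotProduct, Pi.sub_apply]
  refine Finset.measurable_fun_sum _ fun k _ => (measurable_matrix_inv hA l k).mul ?_
  fun_prop

lemma tendsto_inv_mulVec {B : ℕ → Matrix (Fin p) (Fin p) ℝ} {A : Matrix (Fin p) (Fin p) ℝ}
    (hA : IsUnit A.det) (hB : Tendsto B atTop (𝓝 A)) (z : Fin p → ℝ) :
    Tendsto (fun q : ℕ × (Fin p → ℝ) => (B q.1)⁻¹ *ᵥ q.2) (atTop ×ˢ 𝓝 z) (𝓝 (A⁻¹ *ᵥ z)) := by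
  have hinv : Tendsto (fun n => (B n)⁻¹) atTop (𝓝 A⁻¹) := by
    refine (continuousAt_matrix_inv A ?_).tendsto.comp hB
    rw [Ring.inverse_eq_inv']
    exact continuousAt_inv₀ hA.ne_zero
  have hc : Continuous fun q : Matrix (Fin p) (Fin p) ℝ × (Fin p → ℝ) => q.1 *ᵥ q.2 :=
    continuous_fst.matrix_mulVec continuous_snd
  exact (hc.tendsto (A⁻¹, z)).comp ((hinv.comp tendsto_fst).prodMk_nhds tendsto_snd)

lemma measurable_mulVec (B : Matrix (Fin p) (Fin p) ℝ) :
    Measurable fun z : Fin p → ℝ => B *ᵥ z :=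
  (continuous_const.matrix_mulVec continuous_id).measurable

end Residuals

/-! ### The alternative, and divergence of the rank statistic -/

section Alternative

variable {Ω : Type*} [MeasurableSpace Ω] {P : Measure Ω} {p : ℕ}

/-- Take location zero and `Z = A⁻¹ X`. In contrapositive form, the limiting residuals are dependent
whatever the nonsingular pseudo-true matrix. -/
lemma followsICM_of_iIndepFun {X : Ω → Fin p → ℝ} (hX : Measurable X)
    {A : Matrix (Fin p) (Fin p) ℝ} (hA : IsUnit A.det)
    (h : iIndepFun (fun l ω => (A⁻¹ *ᵥ X ω) l) P) : FollowsICM P X :=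
  ⟨0, A, fun ω => A⁻¹ *ᵥ X ω, hA, (measurable_mulVec _).comp hX, h, ae_of_all _ fun ω => by
    rw [Matrix.mulVec_mulVec, Matrix.mul_nonsing_inv A hA, Matrix.one_mulVec, zero_add]⟩

/-- The rank-based statistic diverges when the limiting residuals are dependent with continuous
margins. -/
lemma tendsto_statRank_atTop {W : (Fin p → ℝ) → ℝ}
    (hW_pos : ∀ᵐ t : Fin p → ℝ, 0 < W t) (hW_int : Integrable W)
    {μ : Measure (Fin p → ℝ)} [IsProbabilityMeasure μ] {x : ℕ → Fin p → ℝ}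
    (hx : ∀ G : Set (Fin p → ℝ), IsOpen G → μ G ≤ liminf (fun n => empMeasure x n G) atTop)
    {g' : ℕ → (Fin p → ℝ) → Fin p → ℝ} {g : (Fin p → ℝ) → Fin p → ℝ}
    (hg' : ∀ n, Measurable (g' n)) (hg : Measurable g)
    (hlim : ∀ z, Tendsto (fun q : ℕ × (Fin p → ℝ) => g' q.1 q.2) (atTop ×ˢ 𝓝 z) (𝓝 (g z)))
    (hatom : ∀ l c, μ {z | g z l = c} = 0)
    (hdep : ¬ iIndepFun (fun l z => g z l) μ) {J : Fin p → ℝ → ℝ}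
    (hJ : ∀ l, StrictMonoOn (J l) (Set.Ioo 0 1) ∨ StrictAntiOn (J l) (Set.Ioo 0 1)) :
    Tendsto (fun n => statRank J W n (fun j : Fin n => g' n (x j))) atTop atTop := by
  choose J' hJ'm hJ'eq hJ'inj D hD hJ'c using fun l => exists_measurable_score (hJ l)
  have hgl : ∀ l, Measurable fun z => g z l := fun l => (measurable_pi_apply l).comp hg
  have hgl' : ∀ n l, Measurable fun z => g' n z l := fun n l =>
    (measurable_pi_apply l).comp (hg' n)
  have hprob : ∀ l, IsProbabilityMeasure (μ.map fun z => g z l) := fun l =>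
    Measure.isProbabilityMeasure_map (hgl l).aemeasurable
  have hnull : ∀ l, NullSingletonClass (μ.map fun z => g z l) := fun l => ⟨fun c => by
    rw [Measure.map_apply (hgl l) (measurableSet_singleton c)]
    exact hatom l c⟩
  set F : Fin p → ℝ → ℝ := fun l => cdf (μ.map fun z => g z l) with hF
  have hFm : ∀ l, Measurable (F l) := fun l => (monotone_cdf _).measurable
  choose B hBm hBae hBinj hBmaps using fun l => exists_injOn_cdf (μ.map fun z => g z l)
  have hBae' : ∀ l, ∀ᵐ z ∂μ, g z l ∈ B l := fun l =>
    ae_of_ae_map (hgl l).aemeasurable (hBae l)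
  -- The scores may jump, but at countably many levels only, and each level set of the limiting
  -- distribution function is null.
  have hDae : ∀ l, ∀ᵐ z ∂μ, F l (g z l) ∉ D l := by
    intro l
    have h1 : ∀ u ∈ D l, ∀ᵐ s ∂(μ.map fun z => g z l), F l s ≠ u := fun u _ => by
      rw [ae_iff]; simpa using measure_cdf_eq (μ.map fun z => g z l) u
    filter_upwards [ae_of_ae_map (hgl l).aemeasurable ((ae_ball_iff (hD l)).2 h1)] with z hz hmem
    exact hz _ hmem rfl
  have key := tendsto_statT_atTop hW_pos hW_int hx
    (T' := fun n z l => J' l (normRank x (fun y => g' n y l) n z))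
    (T := fun z l => J' l (F l (g z l)))
    (fun n => measurable_pi_lambda _ fun l =>
      (hJ'm l).comp (measurable_normRank x (hgl' n l) n))
    (measurable_pi_lambda _ fun l => (hJ'm l).comp ((hFm l).comp (hgl l)))
    (by
      filter_upwards [ae_all_iff.2 hBae', ae_all_iff.2 hDae] with z hzB hzD
      refine tendsto_pi_nhds.2 fun l => ?_
      have h1 := tendsto_normRank hx (g' := fun n y => g' n y l) (g := fun y => g y l)
        (fun n => hgl' n l) (hgl l) (fun y => (tendsto_pi_nhds.1 (hlim y)) l) (hatom l) z
      exact (hJ'c l _ (hBmaps l (hzB l)) (hzD l)).tendsto.comp h1)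
    (fun hind => hdep (iIndepFun_of_injOn_comp (h := fun l s => J' l (F l s)) (B := B)
      (fun l => (hJ'm l).comp (hFm l)) hBm
      (fun l => (hJ'inj l).comp (hBinj l) (hBmaps l)) hBae' hind))
  refine key.congr fun n => ?_
  rw [statRank]
  congr 1
  funext j l
  -- Each observation counts itself, so its rank lies between `1` and `n`; division by `n + 1` lands
  -- in the open interval where `J'` and `J` agree.
  refine hJ'eq l ⟨?_, ?_⟩
  · refine div_pos ?_ (by positivity)
    exact_mod_cast Finset.card_pos.2 ⟨j, by simp⟩
  · rw [normRank, div_lt_one (by positivity)]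
    have : (Finset.univ.filter
      (fun k : Fin n => g' n (x k) l ≤ g' n (x j) l)).card ≤ n := by
      simpa using Finset.card_filter_le (Finset.univ : Finset (Fin n))
        (fun k : Fin n => g' n (x k) l ≤ g' n (x j) l)
    have h2 : ((Finset.univ.filter
      (fun k : Fin n => g' n (x k) l ≤ g' n (x j) l)).card : ℝ) ≤ n := by exact_mod_cast this
    linarith

end Alternative

end ICMTest

end

/-! ### Consistency of both families of tests -/

theorem mainTheorem3 {Ω : Type*} [MeasurableSpace Ω] (P : Measure Ω) [IsProbabilityMeasure P]
    {p : ℕ} (X : ℕ → Ω → Fin p → ℝ)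
    (hX_meas : ∀ i, Measurable (X i))
    (hX_indep : iIndepFun X P)
    (hX_ident : ∀ i, IdentDistrib (X i) (X 0) P P)
    (mHat : (n : ℕ) → (Fin n → Fin p → ℝ) → Fin p → ℝ)
    (hm_meas : ∀ n, Measurable (mHat n))
    (AHat : (n : ℕ) → (Fin n → Fin p → ℝ) → Matrix (Fin p) (Fin p) ℝ)
    (hA_meas : ∀ n k l, Measurable (fun x => AHat n x k l))
    (W : (Fin p → ℝ) → ℝ)
    (hW_pos : ∀ᵐ t : Fin p → ℝ, 0 < W t)
    (hW_int : Integrable W)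
    (A : Matrix (Fin p) (Fin p) ℝ)
    (hA_full : IsUnit A.det)
    (hA_lim : ∀ᵐ ω ∂P, Tendsto (fun n => AHat n (fun j : Fin n => X j ω)) atTop (𝓝 A))
    (hH1 : ¬ ICMTest.FollowsICM P (X 0)) :
    ICMTest.TestsConsistent P
      (fun n ω => ICMTest.residuals (mHat n (fun j : Fin n => X j ω))
        (AHat n (fun j : Fin n => X j ω)) (fun j : Fin n => X j ω))
      (ICMTest.statT W) ∧
    ∀ J : Fin p → ℝ → ℝ,
      (∀ l, StrictMonoOn (J l) (Set.Ioo 0 1) ∨ StrictAntiOn (J l) (Set.Ioo 0 1)) →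
      (∀ (l : Fin p) (x : ℝ), P {ω | (A⁻¹ *ᵥ X 0 ω) l = x} = 0) →
      ICMTest.TestsConsistent P
        (fun n ω => ICMTest.residuals (mHat n (fun j : Fin n => X j ω))
          (AHat n (fun j : Fin n => X j ω)) (fun j : Fin n => X j ω))
        (ICMTest.statRank J W) := by
  have hμ : IsProbabilityMeasure (P.map (X 0)) :=
    Measure.isProbabilityMeasure_map (hX_meas 0).aemeasurable
  have hdep : ¬ iIndepFun (fun l z => (A⁻¹ *ᵥ z) l) (P.map (X 0)) := fun h =>
    hH1 (ICMTest.followsICM_of_iIndepFun (hX_meas 0) hA_full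
      ((ICMTest.iIndepFun_map_iff (hX_meas 0)
        fun l => (measurable_pi_apply l).comp (ICMTest.measurable_mulVec _)).1 h))
  have hemp := ICMTest.ae_le_liminf_empMeasure P X hX_meas hX_indep hX_ident
  have hxm : ∀ n, Measurable fun ω => (fun j : Fin n => X j ω) := fun n =>
    measurable_pi_lambda _ fun j => hX_meas j
  have hYm : ∀ n, Measurable fun ω => ICMTest.residuals (mHat n (fun j : Fin n => X j ω))
      (AHat n (fun j : Fin n => X j ω)) (fun j : Fin n => X j ω) := fun n =>
    ICMTest.measurable_residuals ((hm_meas n).comp (hxm n))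
      (fun k l => (hA_meas n k l).comp (hxm n)) (hxm n)
  refine ⟨?_, fun J hJ hcont => ?_⟩
  · refine ICMTest.testsConsistent_of_tendsto_atTop P _ _ (C := (p + 1) * ∫ t, W t)
      (fun n y => ICMTest.statT_nonneg hW_pos y)
      (fun n hn y => ICMTest.sum_perms_statT_le hW_pos hW_int hn y)
      (fun n π => (ICMTest.continuous_statT hW_int).measurable.comp
        ((ICMTest.measurable_permuteComponents π).comp (hYm n))) ?_
    filter_upwards [hemp, hA_lim] with ω hω hAω
    simp only [ICMTest.statT_residuals]
    exact ICMTest.tendsto_statT_atTop hW_pos hW_int hω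
      (T' := fun n z => (AHat n (fun j : Fin n => X j ω))⁻¹ *ᵥ z)
      (fun n => ICMTest.measurable_mulVec _) (ICMTest.measurable_mulVec _)
      (ae_of_all _ fun z => ICMTest.tendsto_inv_mulVec hA_full hAω z) hdep
  · refine ICMTest.testsConsistent_of_tendsto_atTop P _ _ (C := (p + 1) * ∫ t, W t)
      (fun n y => ICMTest.statT_nonneg hW_pos _)
      (fun n hn y => ?_)
      (fun n π => (ICMTest.continuous_statT hW_int).measurable.comp
        ((ICMTest.measurable_scoredRanks J).comp
          ((ICMTest.measurable_permuteComponents π).comp (hYm n)))) ?_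
    · simp only [ICMTest.statRank, ICMTest.scoredRanks_permuteComponents]
      exact ICMTest.sum_perms_statT_le hW_pos hW_int hn _
    · filter_upwards [hemp, hA_lim] with ω hω hAω
      have h := ICMTest.tendsto_statRank_atTop hW_pos hW_int hω
        (g' := fun n z => (AHat n (fun j : Fin n => X j ω))⁻¹ *ᵥ z)
        (fun n => ICMTest.measurable_mulVec _) (ICMTest.measurable_mulVec A⁻¹)
        (fun z => ICMTest.tendsto_inv_mulVec hA_full hAω z)
        (fun l c => by
          have hm : MeasurableSet {z : Fin p → ℝ | (A⁻¹ *ᵥ z) l = c} :=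
            ((measurable_pi_apply l).comp (ICMTest.measurable_mulVec A⁻¹))
              (measurableSet_singleton c)
          rw [Measure.map_apply (hX_meas 0) hm]
          exact hcont l c) hdep hJ
      refine h.congr fun n => ?_
      simp only [ICMTest.statRank, ICMTest.scoredRanks_residuals]
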